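/- **Setting.** Let $\mathcal X$ be a measurable space, $\mathcal Z=\mathcal X\times\mathbb R$, let $K,T,n\ge 1$ be integers, and let $\ell:\mathbb R\times\mathbb R\to[0,1]$ be a measurable loss that is $1$-Lipschitz in its first argument. Let $\mathcal H$ be a class of measurable maps $h:\mathcal X\to\mathbb R^K$ and let $\mathcal F$ be a class of functions $f:\mathbb R^K\to\mathbb R$ with Euclidean Lipschitz constant at most $L>0$; to make suprema over $\mathcal H$ measurable, $\mathcal H$ is assumed to contain a countable subset that is dense in it for pointwise convergence. Let $\eta$ be an environment, that is, a probability measure on the set of probability measures on $\mathcal Z$. Put $$\mu_\eta(A)=\mathbb E_{\mu\sim\eta}[\mu(A)]\quad(A\subseteq\mathcal Z),\qquad \rho_\eta(A)=\mathbb E_{\mu\sim\eta}[\mu^n(A)]\quad(A\subseteq\mathcal Z^n).$$ The data are a multisample $\bar{\mathbf Z}=(\mathbf Z_1,\dots,\mathbf Z_T)\sim\rho_\eta^T$ with $\mathbf Z_t=((X_{t1},Y_{t1}),\dots,(X_{tn},Y_{tn}))$ and $\mathbf X_t=(X_{t1},\dots,X_{tn})$. Let $\hat h$ be a solution of multitask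 representation learning: $\hat h\in\mathcal H$ and, for some $\hat f_1,\dots,\hat f_T\in\mathcal F$, $(\hat h,\hat f_1,\dots,\hat f_T)$ minimizes $\frac1{nT}\sum_{t=1}^T\sum_{i=1}^n\ell(f_t(h(X_{ti})),Y_{ti})$ over $h\in\mathcal H$ and $(f_1,\dots,f_T)\in\mathcal F^T$. For $h\in\mathcal H$ and $\mathbf Z=((X_i,Y_i))_{i\le n}\in\mathcal Z^n$ let $\hat f_{h,\mathbf Z}\in\mathcal F$ be a minimizer, chosen measurably in $\mathbf Z$, of $f\mapsto\frac1n\sum_{i=1}^n\ell(f(h(X_i)),Y_i)$ over $\mathcal F$ (assumed to exist), and define $$\mathcal E_\eta(h)=\mathbb E_{\mu\sim\eta}\,\mathbb E_{\mathbf Z\sim\mu^n}\,\mathbb E_{(X,Y)\sim\mu}\big[\ell(\hat f_{h,\mathbf Z}(h(X)),Y)\big],\qquad \mathcal E_\eta^*=\inf_{h\in\mathcal H}\mathbb E_{\mu\sim\eta}\Big[\inf_{f\in\mathcal F}\mathbb E_{(X,Y)\sim\mu}\,\ell(f(h(X)),Y)\Big].$$ With independent standard normal variables $\gamma$ and Euclidean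 norms let $$G(\mathcal H(\bar{\mathbf X}))=\mathbb E_\gamma\sup_{h\in\mathcal H}\sum_{k,t,i}\gamma_{kti}\,h_k(X_{ti}),\qquad Q'=\sup_{y\in\mathbb R^{Kn}\setminus\{0\}}\frac1{\|y\|}\,\mathbb E_\gamma\sup_{f\in\mathcal F}\sum_{i=1}^n\gamma_i f(y_i),$$ where $y=(y_1,\dots,y_n)$ with $y_i\in\mathbb R^K$, and let $\|h(\mathbf X_t)\|^2=\sum_{i=1}^n\|h(X_{ti})\|^2$. Assume $Q'<\infty$ (which holds, for instance, if $f(0)=0$ for all $f\in\mathcal F$). The bounds below may take the value $+\infty$, with the convention $0\cdot\infty=0$. **Theorem.** Let $\delta>0$. (i) With probability at least $1-\delta$ in the draw of $\bar{\mathbf Z}\sim\rho_\eta^T$, every solution $\hat h$ satisfies $$\mathcal E_\eta(\hat h)-\mathcal E_\eta^*\le\frac{\sqrt{2\pi}\,L\,G(\mathcal H(\bar{\mathbf X}))}{T\sqrt n}+\sqrt{2\pi}\,Q'\sup_{h\in\mathcal H}\sqrt{\frac{\mathbb E_{(X,Y)\sim\mu_\eta}\big[\|h(X)\|^2\big]}{n}}+\sqrt{\frac{8\ln(4/\delta)}{T}}.$$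 (ii) With probability at least $1-\delta$ in the draw of $\bar{\mathbf Z}\sim\rho_\eta^T$, every solution $\hat h$ satisfies $$\mathcal E_\eta(\hat h)-\mathcal E_\eta^*\le\frac{\sqrt{2\pi}\,L\,G(\mathcal H(\bar{\mathbf X}))}{T\sqrt n}+\frac{\sqrt{2\pi}\,Q'\,\frac1T\sum_{t=1}^T\sup_{h\in\mathcal H}\|h(\mathbf X_t)\|}{n}+5\sqrt{\frac{\ln(8/\delta)}{T}}.$$ -/

import Mathlib

open MeasureTheory ProbabilityTheory

noncomputable section

/-- Expectation of an extended-real random variable: `E[φ⁺] - E[φ⁻]`. -/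
def extExpectation {Ω : Type*} [MeasurableSpace Ω] (P : Measure Ω) (φ : Ω → EReal) : EReal :=
  ((∫⁻ ω, (φ ω).toENNReal ∂P : ENNReal) : EReal) - ((∫⁻ ω, (-φ ω).toENNReal ∂P : ENNReal) : EReal)

/-- The Gaussian average `G(S) = E sup_{y ∈ S} ∑ i, γ i * y i` of a set of vectors, with independent
standard normal `γ i`. It is `⊤` if `S` is unbounded and a nonnegative real number if `S` is bounded
and nonempty. -/
def gaussianAverage {ι : Type*} [Fintype ι] (S : Set (ι → ℝ)) : EReal :=
  extExpectation (Measure.pi fun _ : ι => gaussianReal 0 1)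
    fun γ => ⨆ y ∈ S, ((∑ i, γ i * y i : ℝ) : EReal)

/-- `Q'(F) = sup_{y ≠ 0} (1 / ‖y‖) E sup_{f ∈ F} ∑ i, γ i * f (y i)`, where `y = (y 1, …, y n)`
ranges over `ℝ^{Kn}` with its Euclidean norm and each `y i` is in `ℝ^K`. -/
def qPrime {K : ℕ} (n : ℕ) (F : Set (EuclideanSpace ℝ (Fin K) → ℝ)) : EReal :=
  ⨆ y : PiLp 2 fun _ : Fin n => EuclideanSpace ℝ (Fin K), ⨆ _ : y ≠ 0,
    ((1 / ‖y‖ : ℝ) : EReal) * gaussianAverage ((fun f (i : Fin n) => f (y i)) '' F)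

section Setting

variable {X : Type*} {K T n : ℕ}

/-- The set `H(X̄) = {(h_k(X_{ti}))_{t,i,k} : h ∈ H}` of vectors in `ℝ^{KTn}`, for a multisample
`Z t i = (X_{ti}, Y_{ti})`. -/
def representationSet (H : Set (X → EuclideanSpace ℝ (Fin K))) (Z : Fin T → Fin n → X × ℝ) :
    Set (Fin T × Fin n × Fin K → ℝ) :=
  (fun h p => h (Z p.1 p.2.1).1 p.2.2) '' H

/-- The vector `h(X) = (h(X_1), …, h(X_n))` of `ℝ^{Kn}`, with the Euclidean norm, for a sample
`z i = (X_i, Y_i)`. -/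
def representedSample (h : X → EuclideanSpace ℝ (Fin K)) (z : Fin n → X × ℝ) :
    PiLp 2 fun _ : Fin n => EuclideanSpace ℝ (Fin K) :=
  WithLp.toLp 2 fun i => h (z i).1

/-- The empirical risk `(1/n) ∑ i, ℓ(f(h(X_i)), Y_i)` of `f ∘ h` on one sample. -/
def empiricalRisk (l : ℝ → ℝ → ℝ) (z : Fin n → X × ℝ) (h : X → EuclideanSpace ℝ (Fin K))
    (f : EuclideanSpace ℝ (Fin K) → ℝ) : ℝ :=
  (1 / (n : ℝ)) * ∑ i, l (f (h (z i).1)) (z i).2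

/-- The objective `(1/(nT)) ∑ t, ∑ i, ℓ(f_t(h(X_{ti})), Y_{ti})` of multitask representation
learning. -/
def multitaskRisk (l : ℝ → ℝ → ℝ) (Z : Fin T → Fin n → X × ℝ) (h : X → EuclideanSpace ℝ (Fin K))
    (f : Fin T → EuclideanSpace ℝ (Fin K) → ℝ) : ℝ :=
  (1 / ((n : ℝ) * (T : ℝ))) * ∑ t, ∑ i, l (f t (h (Z t i).1)) (Z t i).2

/-- `h` (together with some `f_1, …, f_T ∈ F`) solves the multitask representation learning problem
for the multisample `Z`. -/
def IsMTRLSolution (l : ℝ → ℝ → ℝ) (H : Set (X → EuclideanSpace ℝ (Fin K)))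
    (F : Set (EuclideanSpace ℝ (Fin K) → ℝ)) (Z : Fin T → Fin n → X × ℝ)
    (h : X → EuclideanSpace ℝ (Fin K)) : Prop :=
  h ∈ H ∧ ∃ f : Fin T → EuclideanSpace ℝ (Fin K) → ℝ, (∀ t, f t ∈ F) ∧
    ∀ h' ∈ H, ∀ f' : Fin T → EuclideanSpace ℝ (Fin K) → ℝ, (∀ t, f' t ∈ F) →
      multitaskRisk l Z h f ≤ multitaskRisk l Z h' f'

/-- `fhat h z` is, for every `h ∈ H` and every sample `z`, a minimizer over `F` of the empirical risk
of `f ∘ h` on `z`. -/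
def IsEmpiricalMinimizer (l : ℝ → ℝ → ℝ) (H : Set (X → EuclideanSpace ℝ (Fin K)))
    (F : Set (EuclideanSpace ℝ (Fin K) → ℝ))
    (fhat : (X → EuclideanSpace ℝ (Fin K)) → (Fin n → X × ℝ) → EuclideanSpace ℝ (Fin K) → ℝ) :
    Prop :=
  ∀ h ∈ H, ∀ z, fhat h z ∈ F ∧ ∀ f ∈ F, empiricalRisk l z h (fhat h z) ≤ empiricalRisk l z h f

variable [MeasurableSpace X]

/-- The mixture `μ_η(A) = E_{μ ∼ η} μ(A)`. -/
def mixture (η : Measure (ProbabilityMeasure (X × ℝ))) : Measure (X × ℝ) :=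
  η.bind fun μ => (μ : Measure (X × ℝ))

/-- The law `ρ_η(A) = E_{μ ∼ η} μ^n(A)` of an `n`-sample of a random task. -/
def sampleLaw (n : ℕ) (η : Measure (ProbabilityMeasure (X × ℝ))) : Measure (Fin n → X × ℝ) :=
  η.bind fun μ => Measure.pi fun _ : Fin n => (μ : Measure (X × ℝ))

/-- The risk `E_{μ ∼ η} E_{Z ∼ μ^n} E_{(X,Y) ∼ μ} ℓ(a(h)_Z(X), Y)`, with `a(h)_Z = fhat h Z ∘ h`. -/
def environmentRisk (l : ℝ → ℝ → ℝ) (η : Measure (ProbabilityMeasure (X × ℝ)))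
    (fhat : (X → EuclideanSpace ℝ (Fin K)) → (Fin n → X × ℝ) → EuclideanSpace ℝ (Fin K) → ℝ)
    (h : X → EuclideanSpace ℝ (Fin K)) : ℝ :=
  ∫ μ, ∫ z, ∫ p, l (fhat h z (h p.1)) p.2 ∂(μ : Measure (X × ℝ))
    ∂(Measure.pi fun _ : Fin n => (μ : Measure (X × ℝ))) ∂η

/-- The optimal risk `inf_{h ∈ H} E_{μ ∼ η} [inf_{f ∈ F} E_{(X,Y) ∼ μ} ℓ(f(h(X)), Y)]`. -/
def optimalRisk (l : ℝ → ℝ → ℝ) (η : Measure (ProbabilityMeasure (X × ℝ)))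
    (H : Set (X → EuclideanSpace ℝ (Fin K))) (F : Set (EuclideanSpace ℝ (Fin K) → ℝ)) : ℝ :=
  ⨅ h : H, ∫ μ, ⨅ f : F, ∫ p, l (f.1 (h.1 p.1)) p.2 ∂(μ : Measure (X × ℝ)) ∂η

end Setting

/-- The property `p` holds with probability at least `1 - δ`: it holds on a measurable event of
probability at least `1 - δ`. -/
def WithProbAtLeast {Ω : Type*} [MeasurableSpace Ω] (P : Measure Ω) (δ : ℝ) (p : Ω → Prop) : Prop :=
  ∃ E : Set Ω, MeasurableSet E ∧ ENNReal.ofReal (1 - δ) ≤ P E ∧ ∀ ω ∈ E, p ω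

end

/-!
Write `r h z` for the empirical risk on the task sample `z` of `h` composed with the predictor
trained on `z`, i.e. the minimum over `F`. A solution of multitask representation learning minimizes
the empirical mean of `r h` over `T` independent samples from `ρ_η`. A single bounded-differences
inequality, applied to the expected deviation of a ghost sample from the data, plus the empirical
minimum, minus twice the Rademacher average (and, for part (ii), minus a data-dependent term),
controls all deviations at once; this is why one logarithm `log (1 / δ)` is enough.

The mean of `r h` falls short of the environment risk of `h` by at most an estimation error inside
the tasks, which symmetrization bounds by a Rademacher average over `F`; it never exceeds the mean
of the best risks over `F`. Rademacher averages pass to Gaussian averages by replacing one sign at a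
time by a Gaussian vector, at the price of the factor `√(π / 2)`, as `E|γ| = √(2 / π)`: `r h z` is
`L / √n`-Lipschitz in the vector `h(X)`, which yields the term in `L * G`, and the loss is
`1`-Lipschitz in the prediction, which yields the term in `Q'`.
-/

noncomputable section

open Filter Function Real
open scoped BigOperators NNReal ENNReal Topology

section Products

lemma integrable_of_abs_le {Ω : Type*} [MeasurableSpace Ω] {μ : Measure Ω} [IsFiniteMeasure μ]
    {f : Ω → ℝ} (hf : Measurable f) {B : ℝ} (hB : ∀ x, |f x| ≤ B) : Integrable f μ :=
  .of_bound hf.aestronglyMeasurable B (.of_forall hB)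

variable {m : ℕ} {Ω : Fin (m + 1) → Type*} [∀ i, MeasurableSpace (Ω i)]
  (P : ∀ i, Measure (Ω i)) [∀ i, IsProbabilityMeasure (P i)]

lemma measurePreserving_finCons :
    MeasurePreserving (fun q : Ω 0 × (∀ i : Fin m, Ω i.succ) ↦ (Fin.cons q.1 q.2 : ∀ i, Ω i))
      ((P 0).prod (.pi fun i ↦ P i.succ)) (.pi P) := by
  have hcons : ⇑(MeasurableEquiv.piFinSuccAbove Ω 0).symm = fun q ↦ Fin.cons q.1 q.2 :=
    funext fun q ↦ Fin.insertNth_zero q.1 q.2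
  exact hcons ▸ (measurePreserving_piFinSuccAbove P 0).symm

lemma integral_pi_finCons {f : (∀ i, Ω i) → ℝ} (hf : Integrable f (.pi P)) :
    ∫ Z, f Z ∂(.pi P) = ∫ Z, ∫ x, f (Fin.cons x Z) ∂(P 0) ∂(.pi fun i : Fin m ↦ P i.succ) := by
  have hcons := measurePreserving_finCons P
  rw [← hcons.map_eq, integral_map hcons.measurable.aemeasurable
    (hcons.map_eq.symm ▸ hf.aestronglyMeasurable)]
  exact integral_prod_symm _ (hcons.integrable_comp_of_integrable hf)

section Sums

variable {Ω ι : Type*} [MeasurableSpace Ω] [Fintype ι] {P : Measure Ω} [IsProbabilityMeasure P]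
  {ψ : Ω → ℝ}

lemma integrable_sum_eval (hψ : Integrable ψ P) :
    Integrable (fun Z : ι → Ω ↦ ∑ i, ψ (Z i)) (.pi fun _ ↦ P) :=
  integrable_finsetSum _ fun i _ ↦
    (measurePreserving_eval (fun _ : ι ↦ P) i).integrable_comp_of_integrable hψ

lemma integral_sum_eval (hψ : Integrable ψ P) :
    ∫ Z : ι → Ω, ∑ i, ψ (Z i) ∂(.pi fun _ ↦ P) = Fintype.card ι * ∫ ω, ψ ω ∂P := by
  have hint (i : ι) : Integrable (fun Z : ι → Ω ↦ ψ (Z i)) (.pi fun _ ↦ P) :=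
    (measurePreserving_eval (fun _ ↦ P) i).integrable_comp_of_integrable hψ
  rw [integral_finsetSum _ fun i _ ↦ hint i]
  simp [integral_comp_eval (μ := fun _ : ι ↦ P) hψ.aestronglyMeasurable]

end Sums

end Products

section Suprema

variable {D : Type*} {a b : D → ℝ} {B c : ℝ}

lemma abs_le_one_of_mem_Icc {x : ℝ} (hx : x ∈ Set.Icc (0 : ℝ) 1) : |x| ≤ 1 :=
  abs_le.2 ⟨neg_one_lt_zero.le.trans hx.1, hx.2⟩

lemma bddAbove_range_of_abs_le (ha : ∀ d, |a d| ≤ B) : BddAbove (Set.range a) :=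
  ⟨B, Set.forall_mem_range.2 fun d ↦ (abs_le.1 (ha d)).2⟩

lemma bddBelow_range_of_abs_le (ha : ∀ d, |a d| ≤ B) : BddBelow (Set.range a) :=
  ⟨-B, Set.forall_mem_range.2 fun d ↦ (abs_le.1 (ha d)).1⟩

variable [Nonempty D]

lemma abs_iSup_le (ha : ∀ d, |a d| ≤ B) : |⨆ d, a d| ≤ B :=
  let ⟨d⟩ := ‹Nonempty D›
  abs_le.2 ⟨(abs_le.1 (ha d)).1.trans (le_ciSup (bddAbove_range_of_abs_le ha) d),
    ciSup_le fun d ↦ (abs_le.1 (ha d)).2⟩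

lemma abs_iInf_le (ha : ∀ d, |a d| ≤ B) : |⨅ d, a d| ≤ B :=
  let ⟨d⟩ := ‹Nonempty D›
  abs_le.2 ⟨le_ciInf fun d ↦ (abs_le.1 (ha d)).1,
    (ciInf_le (bddBelow_range_of_abs_le ha) d).trans (abs_le.1 (ha d)).2⟩

lemma iSup_le_iSup_add (hb : BddAbove (Set.range b)) (hab : ∀ d, |a d - b d| ≤ c) :
    ⨆ d, a d ≤ (⨆ d, b d) + c :=
  ciSup_le fun d ↦ by linarith [(abs_le.1 (hab d)).2, le_ciSup hb d]

lemma abs_iSup_sub_iSup_le (ha : BddAbove (Set.range a)) (hb : BddAbove (Set.range b))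
    (hab : ∀ d, |a d - b d| ≤ c) : |(⨆ d, a d) - ⨆ d, b d| ≤ c := by
  have h₁ := iSup_le_iSup_add hb hab
  have h₂ := iSup_le_iSup_add ha fun d ↦ abs_sub_comm (a d) (b d) ▸ hab d
  exact abs_le.2 ⟨by linarith, by linarith⟩

lemma abs_iInf_sub_iInf_le (ha : BddBelow (Set.range a)) (hb : BddBelow (Set.range b))
    (hab : ∀ d, |a d - b d| ≤ c) : |(⨅ d, a d) - ⨅ d, b d| ≤ c := by
  rw [iInf, iInf, Real.sInf_def, Real.sInf_def, ← Set.image_neg_eq_neg, ← Set.image_neg_eq_neg,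
    ← Set.range_comp, ← Set.range_comp, neg_sub_neg, abs_sub_comm]
  refine abs_iSup_sub_iSup_le ?_ ?_ fun d ↦ ?_
  · simpa [Set.range_comp] using ha
  · simpa [Set.range_comp] using hb
  · simpa [neg_add_eq_sub, abs_sub_comm] using hab d

end Suprema

section BoundedDifferences

/-- The bounded differences property of McDiarmid's inequality: changing the `i`-th argument of `f`
changes its value by at most `c i`. -/
def HasBoundedDifferences {ι : Type*} [DecidableEq ι] {Ω : ι → Type*} (f : (∀ i, Ω i) → ℝ)
    (c : ι → ℝ≥0) : Prop :=
  ∀ Z i x y, |f (update Z i x) - f (update Z i y)| ≤ c i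

namespace HasBoundedDifferences

variable {ι : Type*} [DecidableEq ι] {Ω : ι → Type*} {f g : (∀ i, Ω i) → ℝ} {c c' : ι → ℝ≥0}

lemma add (hf : HasBoundedDifferences f c) (hg : HasBoundedDifferences g c') :
    HasBoundedDifferences (fun Z ↦ f Z + g Z) (c + c') := fun Z i x y ↦ by
  rw [add_sub_add_comm]
  exact (abs_add_le _ _).trans (add_le_add (hf Z i x y) (hg Z i x y))

lemma const_mul (hf : HasBoundedDifferences f c) (r : ℝ) :
    HasBoundedDifferences (fun Z ↦ r * f Z) (fun i ↦ ‖r‖₊ * c i) := fun Z i x y ↦ by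
  rw [← mul_sub, abs_mul]
  exact mul_le_mul_of_nonneg_left (hf Z i x y) (abs_nonneg r)

lemma sub (hf : HasBoundedDifferences f c) (hg : HasBoundedDifferences g c') :
    HasBoundedDifferences (fun Z ↦ f Z - g Z) (c + c') := fun Z i x y ↦ by
  rw [sub_sub_sub_comm]
  exact (abs_sub _ _).trans (add_le_add (hf Z i x y) (hg Z i x y))

lemma iSup {D : Type*} [Nonempty D] {f : D → (∀ i, Ω i) → ℝ}
    (hbdd : ∀ Z, BddAbove (Set.range fun d ↦ f d Z)) (hf : ∀ d, HasBoundedDifferences (f d) c) :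
    HasBoundedDifferences (fun Z ↦ ⨆ d, f d Z) c := fun Z i x y ↦
  abs_iSup_sub_iSup_le (hbdd _) (hbdd _) fun d ↦ hf d Z i x y

lemma iInf {D : Type*} [Nonempty D] {f : D → (∀ i, Ω i) → ℝ}
    (hbdd : ∀ Z, BddBelow (Set.range fun d ↦ f d Z)) (hf : ∀ d, HasBoundedDifferences (f d) c) :
    HasBoundedDifferences (fun Z ↦ ⨅ d, f d Z) c := fun Z i x y ↦
  abs_iInf_sub_iInf_le (hbdd _) (hbdd _) fun d ↦ hf d Z i x y

lemma integral {Γ : Type*} [MeasurableSpace Γ] {ν : Measure Γ} [IsProbabilityMeasure ν]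
    {f : Γ → (∀ i, Ω i) → ℝ} (hint : ∀ Z, Integrable (fun γ ↦ f γ Z) ν)
    (hf : ∀ γ, HasBoundedDifferences (f γ) c) :
    HasBoundedDifferences (fun Z ↦ ∫ γ, f γ Z ∂ν) c := fun Z i x y ↦ by
  rw [← integral_sub (hint _) (hint _)]
  simpa using norm_integral_le_of_norm_le_const (μ := ν)
    (.of_forall fun γ ↦ (norm_eq_abs _).trans_le (hf γ Z i x y))

lemma abs_sub_le [Fintype ι] (hf : HasBoundedDifferences f c) (Z Z' : ∀ i, Ω i) :
    |f Z - f Z'| ≤ ∑ i, (c i : ℝ) := by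
  suffices h : ∀ s : Finset ι, |f (s.piecewise Z Z') - f Z'| ≤ ∑ i ∈ s, (c i : ℝ) by
    simpa using h Finset.univ
  intro s
  induction s using Finset.induction_on with
  | empty => simp
  | insert i s hi ih =>
    rw [Finset.sum_insert hi, Finset.piecewise_insert]
    have hstep := hf (s.piecewise Z Z') i (Z i) (s.piecewise Z Z' i)
    rw [update_eq_self] at hstep
    exact (_root_.abs_sub_le _ _ _).trans (add_le_add hstep ih)

lemma exists_abs_le [Finite ι] (hf : HasBoundedDifferences f c) : ∃ B, ∀ Z, |f Z| ≤ B := by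
  have := Fintype.ofFinite ι
  rcases isEmpty_or_nonempty (∀ i, Ω i) with _ | ⟨⟨Z₀⟩⟩
  · exact ⟨0, isEmptyElim⟩
  · refine ⟨∑ i, (c i : ℝ) + |f Z₀|, fun Z ↦ ?_⟩
    linarith [hf.abs_sub_le Z Z₀, abs_sub_abs_le_abs_sub (f Z) (f Z₀)]

lemma integrable [Finite ι] [∀ i, MeasurableSpace (Ω i)] {μ : Measure (∀ i, Ω i)}
    [IsFiniteMeasure μ] (hf : HasBoundedDifferences f c) (hfm : Measurable f) : Integrable f μ :=
  let ⟨_, hB⟩ := hf.exists_abs_le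
  integrable_of_abs_le hfm hB

end HasBoundedDifferences

lemma hasBoundedDifferences_sum {ι : Type*} [DecidableEq ι] [Fintype ι] {Ω : ι → Type*}
    {φ : ∀ i, Ω i → ℝ} {c : ι → ℝ≥0} (hφ : ∀ i x y, |φ i x - φ i y| ≤ c i) :
    HasBoundedDifferences (fun Z : ∀ i, Ω i ↦ ∑ i, φ i (Z i)) c := fun Z i x y ↦ by
  have heq : ∑ j, (φ j (update Z i x j) - φ j (update Z i y j)) = φ i x - φ i y := by
    rw [Fintype.sum_eq_single i fun j hj ↦ by simp [update_of_ne hj]]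
    simp
  rw [← Finset.sum_sub_distrib, heq]
  exact hφ i x y

lemma hasSubgaussianMGF_of_abs_sub_le {Ω : Type*} [MeasurableSpace Ω] {P : Measure Ω}
    [IsProbabilityMeasure P] {f : Ω → ℝ} (hf : Measurable f) {c : ℝ≥0}
    (hc : ∀ x y, |f x - f y| ≤ c) :
    HasSubgaussianMGF (fun x ↦ f x - ∫ y, f y ∂P) ((c / 2) ^ 2) P := by
  have hΩ : Nonempty Ω := nonempty_of_isProbabilityMeasure P
  have ⟨x₀⟩ := hΩ
  have hbdd : BddBelow (Set.range f) :=
    ⟨f x₀ - c, Set.forall_mem_range.2 fun y ↦ by linarith [(abs_le.1 (hc x₀ y)).2]⟩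
  have hmem (x : Ω) : f x ∈ Set.Icc (⨅ y, f y) ((⨅ y, f y) + c) := by
    have hle : f x - c ≤ ⨅ y, f y := le_ciInf fun y ↦ by linarith [(abs_le.1 (hc x y)).2]
    exact ⟨ciInf_le hbdd x, by linarith⟩
  simpa using hasSubgaussianMGF_of_mem_Icc (μ := P) hf.aemeasurable (.of_forall hmem)

lemma hasSubgaussianMGF_prod {Ω Ω' : Type*} [MeasurableSpace Ω] [MeasurableSpace Ω']
    {P : Measure Ω} {Q : Measure Ω'} [IsProbabilityMeasure P] [IsProbabilityMeasure Q]
    {f : Ω × Ω' → ℝ} (hf : Measurable f) {B : ℝ} (hB : ∀ q, |f q| ≤ B) {c c' : ℝ≥0}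
    (hP : ∀ y, HasSubgaussianMGF (fun x ↦ f (x, y) - ∫ x', f (x', y) ∂P) c P)
    (hQ : HasSubgaussianMGF (fun y ↦ ∫ x, f (x, y) ∂P) c' Q) :
    HasSubgaussianMGF f (c + c') (P.prod Q) := by
  have hexp (t : ℝ) : Integrable (fun q ↦ exp (t * f q)) (P.prod Q) :=
    integrable_exp_mul_of_mem_Icc hf.aemeasurable (.of_forall fun q ↦ abs_le.1 (hB q))
  refine ⟨hexp, fun t ↦ ?_⟩
  calc mgf f (P.prod Q) t
      = ∫ y, ∫ x, exp (t * f (x, y)) ∂P ∂Q := integral_prod_symm _ (hexp t)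
    _ = ∫ y, mgf (fun x ↦ f (x, y) - ∫ x', f (x', y) ∂P) P t *
          exp (t * ∫ x, f (x, y) ∂P) ∂Q := by
        simp only [mgf, ← integral_mul_const, ← exp_add, ← mul_add, sub_add_cancel]
    _ ≤ ∫ y, exp (c * t ^ 2 / 2) * exp (t * ∫ x, f (x, y) ∂P) ∂Q := by
        refine integral_mono_of_nonneg (.of_forall fun y ↦ mul_nonneg mgf_nonneg (exp_nonneg _))
          ((hQ.integrable_exp_mul t).const_mul _) (.of_forall fun y ↦ ?_)
        exact mul_le_mul_of_nonneg_right ((hP y).mgf_le t) (exp_nonneg _)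
    _ = exp (c * t ^ 2 / 2) * mgf (fun y ↦ ∫ x, f (x, y) ∂P) Q t := integral_const_mul _ _
    _ ≤ exp (c * t ^ 2 / 2) * exp (c' * t ^ 2 / 2) := by gcongr; exact hQ.mgf_le t
    _ = exp ((c + c' : ℝ≥0) * t ^ 2 / 2) := by rw [← exp_add, NNReal.coe_add]; ring_nf

namespace HasBoundedDifferences

lemma hasSubgaussianMGF {m : ℕ} {Ω : Fin m → Type*} [∀ i, MeasurableSpace (Ω i)]
    {P : ∀ i, Measure (Ω i)} [∀ i, IsProbabilityMeasure (P i)] {f : (∀ i, Ω i) → ℝ}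
    {c : Fin m → ℝ≥0} (hf : HasBoundedDifferences f c) (hfm : Measurable f) :
    HasSubgaussianMGF (fun Z ↦ f Z - ∫ Z', f Z' ∂(.pi P)) (∑ i, (c i / 2) ^ 2) (.pi P) := by
  induction m with
  | zero =>
    have hconst (Z) : f Z = f default := congrArg f (Subsingleton.elim _ _)
    simp [hconst]
  | succ m ih =>
    have hcons := measurePreserving_finCons P
    have hmean := integral_pi_finCons P (hf.integrable hfm)
    obtain ⟨B, hB⟩ := hf.exists_abs_le
    set e := ∫ Z, f Z ∂(.pi P)
    have hhead (Z : ∀ i : Fin m, Ω i.succ) (x y) :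
        |f (Fin.cons x Z) - f (Fin.cons y Z)| ≤ c 0 := by
      simpa only [Fin.update_cons_zero] using hf (Fin.cons x Z) 0 x y
    have hslice (Z : ∀ i : Fin m, Ω i.succ) : Measurable fun x ↦ f (Fin.cons x Z) :=
      (hfm.comp hcons.measurable).comp measurable_prodMk_right
    have hslice_int (Z : ∀ i : Fin m, Ω i.succ) : Integrable (fun x ↦ f (Fin.cons x Z)) (P 0) :=
      integrable_of_abs_le (hslice Z) fun x ↦ hB _
    have htail : HasBoundedDifferences (fun Z ↦ ∫ x, f (Fin.cons x Z) ∂(P 0)) fun i ↦ c i.succ :=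
      .integral hslice_int fun x Z i y y' ↦ by simpa only [Fin.cons_update] using hf _ i.succ y y'
    have htail_meas : Measurable fun Z : ∀ i : Fin m, Ω i.succ ↦ ∫ x, f (Fin.cons x Z) ∂(P 0) :=
      (hfm.comp hcons.measurable).stronglyMeasurable.integral_prod_left'.measurable
    have hprod : HasSubgaussianMGF
        (fun q : Ω 0 × (∀ i : Fin m, Ω i.succ) ↦ f (Fin.cons q.1 q.2) - e)
        (∑ i, (c i / 2) ^ 2) ((P 0).prod (.pi fun i ↦ P i.succ)) := by
      rw [Fin.sum_univ_succ]
      refine hasSubgaussianMGF_prod (B := B + |e|) ((hfm.comp hcons.measurable).sub_const e)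
        (fun q ↦ (abs_sub _ _).trans (by gcongr; exact hB _)) (fun Z ↦ ?_) ?_
      · simpa [integral_sub (hslice_int Z)] using
          hasSubgaussianMGF_of_abs_sub_le (hslice Z) (hhead Z)
      · simpa [hmean, integral_sub (hslice_int _)] using ih htail htail_meas
    refine hprod.congr_identDistrib ⟨hprod.aemeasurable, (hfm.sub_const e).aemeasurable, ?_⟩
    rw [← hcons.map_eq, Measure.map_map (hfm.sub_const e) hcons.measurable]
    rfl

end HasBoundedDifferences

lemma WithProbAtLeast.mono {Ω : Type*} [MeasurableSpace Ω] {P : Measure Ω} {δ : ℝ} {p q : Ω → Prop}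
    (hp : WithProbAtLeast P δ p) (hpq : ∀ ω, p ω → q ω) : WithProbAtLeast P δ q :=
  let ⟨E, hE, hPE, h⟩ := hp
  ⟨E, hE, hPE, fun ω hω ↦ hpq ω (h ω hω)⟩

lemma withProbAtLeast_of_forall {Ω : Type*} [MeasurableSpace Ω] {P : Measure Ω}
    [IsProbabilityMeasure P] {δ : ℝ} (hδ : 0 ≤ δ) {p : Ω → Prop} (hp : ∀ ω, p ω) :
    WithProbAtLeast P δ p :=
  ⟨Set.univ, .univ, by simpa using hδ, fun ω _ ↦ hp ω⟩

lemma withProbAtLeast_of_hasSubgaussianMGF {Ω : Type*} [MeasurableSpace Ω] {P : Measure Ω}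
    [IsProbabilityMeasure P] {f : Ω → ℝ} {c : ℝ≥0} (hc : 0 < c) (hf : Measurable f)
    (hsub : HasSubgaussianMGF f c P) {δ : ℝ} (hδ : 0 < δ) :
    WithProbAtLeast P δ fun ω ↦ f ω ≤ √(2 * c * log (1 / δ)) := by
  set s := √(2 * c * log (1 / δ))
  have hE : MeasurableSet {ω | f ω ≤ s} := measurableSet_le hf measurable_const
  have hlog : log (1 / δ) ≤ s ^ 2 / (2 * c) := by
    rw [le_div_iff₀ (by positivity), mul_comm]
    exact (sqrt_le_left (sqrt_nonneg _)).1 le_rfl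
  have htail : P.real {ω | f ω ≤ s}ᶜ ≤ δ := by
    calc P.real {ω | f ω ≤ s}ᶜ
        ≤ P.real {ω | s ≤ f ω} := measureReal_mono fun ω hω ↦ le_of_not_ge (by simpa using hω)
      _ ≤ exp (-s ^ 2 / (2 * c)) := hsub.measure_ge_le (sqrt_nonneg _)
      _ ≤ exp (-log (1 / δ)) := by rw [neg_div]; gcongr
      _ = δ := by rw [one_div, log_inv, neg_neg, exp_log hδ]
  refine ⟨_, hE, ?_, fun ω hω ↦ hω⟩
  rw [measureReal_compl hE, probReal_univ] at htail
  rw [← ofReal_measureReal]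
  exact ENNReal.ofReal_le_ofReal (by linarith)

lemma HasBoundedDifferences.withProbAtLeast {m : ℕ} (hm : 0 < m) {Ω : Type*} [MeasurableSpace Ω]
    {P : Measure Ω} [IsProbabilityMeasure P] {f : (Fin m → Ω) → ℝ} {c : ℝ≥0} (hc : 0 < c)
    (hf : HasBoundedDifferences f fun _ ↦ c) (hfm : Measurable f) {δ : ℝ} (hδ : 0 < δ) :
    WithProbAtLeast (.pi fun _ ↦ P) δ fun Z ↦
      f Z ≤ ∫ Z', f Z' ∂(.pi fun _ ↦ P) + c * √(m * log (1 / δ) / 2) := by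
  have hpos : 0 < ∑ _i : Fin m, (c / 2) ^ 2 :=
    Finset.sum_pos (fun _ _ ↦ by positivity) ⟨⟨0, hm⟩, Finset.mem_univ _⟩
  refine (withProbAtLeast_of_hasSubgaussianMGF hpos (hfm.sub_const _)
    (hf.hasSubgaussianMGF (P := fun _ ↦ P) hfm) hδ).mono
    fun Z hZ ↦ (sub_le_iff_le_add'.1 hZ).trans_eq ?_
  have hdeviation : 2 * ((∑ _i : Fin m, (c / 2) ^ 2 : ℝ≥0) : ℝ) * log (1 / δ) =
      c ^ 2 * (m * log (1 / δ) / 2) := by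
    push_cast [Finset.sum_const, Finset.card_fin, nsmul_eq_mul]
    ring
  rw [hdeviation, sqrt_mul (sq_nonneg _), sqrt_sq c.coe_nonneg]

end BoundedDifferences

section Rademacher

/-- The Rademacher average `E sup_d ∑ i, ε i * a d i` of a family of vectors, with independent
uniform signs `ε i`. -/
def rademacherAverage {D ι : Type*} [Fintype ι] [DecidableEq ι] (a : D → ι → ℝ) : ℝ :=
  𝔼 ε : ι → ℤˣ, ⨆ d, ∑ i, ε i • a d i

lemma abs_intUnits_smul (s : ℤˣ) (x : ℝ) : |s • x| = |x| := by
  rcases Int.units_eq_one_or s with rfl | rfl <;> simp [Units.smul_def]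

lemma abs_sum_intUnits_smul_le {ι : Type*} [Fintype ι] (ε : ι → ℤˣ) {a : ι → ℝ} {B : ℝ}
    (ha : ∀ i, |a i| ≤ B) : |∑ i, ε i • a i| ≤ Fintype.card ι * B := by
  refine (Finset.abs_sum_le_sum_abs _ _).trans ?_
  simpa [abs_intUnits_smul] using Finset.sum_le_sum fun i (_ : i ∈ Finset.univ) ↦ ha i

variable {D ι : Type*} [Fintype ι] [DecidableEq ι] [Nonempty D] {a b : D → ι → ℝ} {B : ℝ}

lemma abs_rademacherAverage_le (ha : ∀ d i, |a d i| ≤ B) :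
    |rademacherAverage a| ≤ Fintype.card ι * B :=
  (Finset.abs_expect_le _ _).trans <| (Finset.expect_le_expect fun ε _ ↦
    abs_iSup_le fun d ↦ abs_sum_intUnits_smul_le ε (ha d)).trans_eq (Fintype.expect_const _)

lemma rademacherAverage_nonneg (ha : ∀ d i, |a d i| ≤ B) : 0 ≤ rademacherAverage a := by
  obtain ⟨d⟩ := ‹Nonempty D›
  calc (0 : ℝ) = 𝔼 ε : ι → ℤˣ, ∑ i, ε i • a d i := by
        refine (self_eq_neg.1 ?_).symm
        rw [← Finset.expect_neg_distrib]
        exact Fintype.expect_equiv (Equiv.neg _) _ _ fun ε ↦ by simp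
    _ ≤ rademacherAverage a := Finset.expect_le_expect fun ε _ ↦
        le_ciSup (bddAbove_range_of_abs_le fun d ↦ abs_sum_intUnits_smul_le ε (ha d)) d

lemma abs_rademacherAverage_sub_le (ha : ∀ d i, |a d i| ≤ B) (hb : ∀ d i, |b d i| ≤ B)
    {c : ι → ℝ} (hab : ∀ d i, |a d i - b d i| ≤ c i) :
    |rademacherAverage a - rademacherAverage b| ≤ ∑ i, c i := by
  have hsign (ε : ι → ℤˣ) :
      |(⨆ d, ∑ i, ε i • a d i) - ⨆ d, ∑ i, ε i • b d i| ≤ ∑ i, c i := by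
    refine abs_iSup_sub_iSup_le
      (bddAbove_range_of_abs_le fun d ↦ abs_sum_intUnits_smul_le ε (ha d))
      (bddAbove_range_of_abs_le fun d ↦ abs_sum_intUnits_smul_le ε (hb d)) fun d ↦ ?_
    rw [← Finset.sum_sub_distrib]
    refine (Finset.abs_sum_le_sum_abs _ _).trans (Finset.sum_le_sum fun i _ ↦ ?_)
    rw [← smul_sub, abs_intUnits_smul]
    exact hab d i
  unfold rademacherAverage
  rw [← Finset.expect_sub_distrib]
  exact (Finset.abs_expect_le _ _).trans <|
    (Finset.expect_le_expect fun ε _ ↦ hsign ε).trans_eq (Fintype.expect_const _)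

end Rademacher

section RademacherGaussianComparison

lemma expect_intUnits (φ : ℤˣ → ℝ) : 𝔼 s, φ s = (φ 1 + φ (-1)) / 2 := by
  rw [Fintype.expect_eq_sum_div_card, UnitsInt.univ, Finset.sum_pair (by decide)]
  rfl

lemma expect_pi_finCons {Ω : Type*} [Fintype Ω] {m : ℕ} (φ : (Fin (m + 1) → Ω) → ℝ) :
    𝔼 ω, φ ω = 𝔼 ω : Fin m → Ω, 𝔼 x, φ (Fin.cons x ω) := by
  rw [Finset.expect_comm, ← Finset.univ.expect_product', Finset.univ_product_univ]
  exact (Fintype.expect_equiv (Fin.consEquiv fun _ ↦ Ω) _ _ fun _ ↦ rfl).symm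

lemma integrable_iSup {I Ω : Type*} [Finite I] [Nonempty I] [MeasurableSpace Ω] {μ : Measure Ω}
    {f : I → Ω → ℝ} (hf : ∀ i, Integrable (f i) μ) : Integrable (fun ω ↦ ⨆ i, f i ω) μ := by
  have := Fintype.ofFinite I
  refine (integrable_finsetSum Finset.univ fun i _ ↦ (hf i).abs).mono'
    (AEMeasurable.iSup fun i ↦ (hf i).aemeasurable).aestronglyMeasurable (.of_forall fun ω ↦ ?_)
  exact abs_iSup_le fun i ↦
    Finset.single_le_sum (f := fun i ↦ |f i ω|) (fun _ _ ↦ abs_nonneg _) (Finset.mem_univ i)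

variable {I Γ : Type*} [Finite I] [Nonempty I] [MeasurableSpace Γ] {ν : Measure Γ}
  [IsProbabilityMeasure ν]

lemma integral_iSup_add_comp {u : I → Γ → ℝ} (hu : ∀ i, Integrable (u i) ν) {σ : Γ → Γ}
    (hσ : MeasurePreserving σ ν ν) (B : I → ℝ) :
    ∫ x, ⨆ i, (B i + u i (σ x)) ∂ν = ∫ x, ⨆ i, (B i + u i x) ∂ν := by
  have hsup : Integrable (fun x ↦ ⨆ i, (B i + u i x)) ν :=
    integrable_iSup fun i ↦ (integrable_const _).add (hu i)
  conv_rhs => rw [← hσ.map_eq, integral_map hσ.measurable.aemeasurable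
    (hσ.map_eq.symm ▸ hsup.aestronglyMeasurable)]

lemma iSup_add_iSup_sub_le_integral {u : I → Γ → ℝ} (hu : ∀ i, Integrable (u i) ν) {σ : Γ → Γ}
    (hσ : MeasurePreserving σ ν ν) (hodd : ∀ i x, u i (σ x) = -u i x) {ψ : I → ℝ}
    (hψ : ∀ i j, |ψ i - ψ j| ≤ ∫ x, |u i x - u j x| ∂ν) (B : I → ℝ) :
    ((⨆ i, (B i + ψ i)) + ⨆ i, (B i - ψ i)) / 2 ≤ ∫ x, ⨆ i, (B i + u i x) ∂ν := by
  obtain ⟨i, hi⟩ := exists_eq_ciSup_of_finite (f := fun i ↦ B i + ψ i)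
  obtain ⟨j, hj⟩ := exists_eq_ciSup_of_finite (f := fun i ↦ B i - ψ i)
  have hplus : Integrable (fun x ↦ ⨆ i, (B i + u i x)) ν :=
    integrable_iSup fun i ↦ (integrable_const _).add (hu i)
  have hminus : Integrable (fun x ↦ ⨆ i, (B i + u i (σ x))) ν :=
    hσ.integrable_comp_of_integrable hplus
  have hpt (x : Γ) : B i + B j + |u i x - u j x| ≤
      (⨆ i, (B i + u i x)) + ⨆ i, (B i + u i (σ x)) := by
    have h₁ (k) := le_ciSup (Set.finite_range fun i ↦ B i + u i x).bddAbove k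
    have h₂ (k) := le_ciSup (Set.finite_range fun i ↦ B i + u i (σ x)).bddAbove k
    simp only [hodd] at h₁ h₂ ⊢
    rcases abs_cases (u i x - u j x) with h | h
    · linarith [h₁ i, h₂ j]
    · linarith [h₁ j, h₂ i]
  have habs : Integrable (fun x ↦ |u i x - u j x|) ν := ((hu i).sub (hu j)).abs
  have hle := integral_mono ((integrable_const _).add habs) (hplus.add hminus) hpt
  rw [integral_add' (integrable_const _) habs, integral_add' hplus hminus,
    integral_iSup_add_comp hu hσ, integral_const, probReal_univ, one_smul] at hle
  linarith [le_abs_self (ψ i - ψ j), hψ i j]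

lemma integrable_iSup_add_sum_eval {ι : Type*} [Fintype ι] {u : I → ι → Γ → ℝ}
    (hu : ∀ i t, Integrable (u i t) ν) (A : I → ℝ) :
    Integrable (fun γ : ι → Γ ↦ ⨆ i, (A i + ∑ t, u i t (γ t))) (.pi fun _ ↦ ν) :=
  integrable_iSup fun i ↦ (integrable_const _).add <| integrable_finsetSum _ fun t _ ↦
    (measurePreserving_eval (fun _ ↦ ν) t).integrable_comp_of_integrable (hu i t)

lemma expect_iSup_le_integral_iSup {m : ℕ} {ψ : I → Fin m → ℝ} {u : I → Fin m → Γ → ℝ}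
    (hu : ∀ i t, Integrable (u i t) ν)
    (hψ : ∀ t (B : I → ℝ), 𝔼 s : ℤˣ, ⨆ i, (B i + s • ψ i t) ≤ ∫ x, ⨆ i, (B i + u i t x) ∂ν)
    (A : I → ℝ) :
    𝔼 ε : Fin m → ℤˣ, ⨆ i, (A i + ∑ t, ε t • ψ i t) ≤
      ∫ γ, ⨆ i, (A i + ∑ t, u i t (γ t)) ∂(.pi fun _ : Fin m ↦ ν) := by
  induction m generalizing A with
  | zero => simp
  | succ m ih =>
    have hint (A : I → ℝ) := integrable_iSup_add_sum_eval (ν := ν)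
      (u := fun i (t : Fin m) ↦ u i t.succ) (fun i t ↦ hu i t.succ) A
    have hint_slice : Integrable (fun γ : Fin m → Γ ↦
        ∫ x, ⨆ i, (A i + ∑ t, u i t.succ (γ t) + u i 0 x) ∂ν) (.pi fun _ : Fin m ↦ ν) := by
      have := ((measurePreserving_finCons fun _ : Fin (m + 1) ↦ ν).integrable_comp_of_integrable
        (integrable_iSup_add_sum_eval hu A)).integral_prod_right
      simpa [Fin.sum_univ_succ, ← add_assoc, add_right_comm _ (∑ _, _)] using this
    calc 𝔼 ε : Fin (m + 1) → ℤˣ, ⨆ i, (A i + ∑ t, ε t • ψ i t)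
        = 𝔼 s : ℤˣ, 𝔼 ε : Fin m → ℤˣ, ⨆ i, (A i + s • ψ i 0 + ∑ t, ε t • ψ i t.succ) := by
          rw [expect_pi_finCons, Finset.expect_comm]
          simp only [Fin.sum_univ_succ, Fin.cons_zero, Fin.cons_succ, add_assoc]
      _ ≤ 𝔼 s : ℤˣ, ∫ γ, ⨆ i, (A i + s • ψ i 0 + ∑ t, u i t.succ (γ t)) ∂(.pi fun _ : Fin m ↦ ν) :=
          Finset.expect_le_expect fun s _ ↦ ih (fun i t ↦ hu i t.succ) (fun t ↦ hψ t.succ) _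
      _ = ∫ γ, 𝔼 s : ℤˣ, ⨆ i, (A i + ∑ t, u i t.succ (γ t) + s • ψ i 0)
            ∂(.pi fun _ : Fin m ↦ ν) := by
          simp only [expect_intUnits, add_right_comm _ (∑ _, _)]
          rw [integral_div, integral_add (hint _) (hint _)]
      _ ≤ ∫ γ, ∫ x, ⨆ i, (A i + ∑ t, u i t.succ (γ t) + u i 0 x) ∂ν ∂(.pi fun _ : Fin m ↦ ν) := by
          refine integral_mono ?_ hint_slice fun γ ↦ hψ 0 _
          simp only [expect_intUnits, add_right_comm _ (∑ _, _)]
          exact ((hint _).add (hint _)).div_const 2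
      _ = ∫ γ, ⨆ i, (A i + ∑ t, u i t (γ t)) ∂(.pi fun _ : Fin (m + 1) ↦ ν) := by
          rw [integral_pi_finCons _ (integrable_iSup_add_sum_eval hu A)]
          simp only [Fin.sum_univ_succ, Fin.cons_zero, Fin.cons_succ]
          congr with γ; congr with x; congr with i; ring

end RademacherGaussianComparison

section GaussianMoments

/-- The law of a family of independent standard normal variables, the `γ` of
`gaussianAverage`. -/
abbrev stdGaussianPi (ι : Type*) [Fintype ι] : Measure (ι → ℝ) :=
  .pi fun _ ↦ gaussianReal 0 1

lemma integral_abs_gaussianReal : ∫ x, |x| ∂(gaussianReal 0 1) = √(2 / π) := by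
  let φ (x : ℝ) : ℝ := (√(2 * π))⁻¹ * (x * exp (-(1 / 2) * x ^ 2))
  have hφ (x : ℝ) : gaussianPDFReal 0 1 x • |x| = φ |x| := by
    simp only [gaussianPDFReal, NNReal.coe_one, mul_one, sub_zero, sq_abs, smul_eq_mul, φ]
    ring_nf
  have hmoment := integral_rpow_mul_exp_neg_mul_rpow (p := 2) (q := 1) (b := 1 / 2) two_pos
    (by norm_num) (by norm_num)
  simp only [rpow_one, rpow_two] at hmoment
  rw [integral_gaussianReal_eq_integral_smul one_ne_zero, funext hφ, integral_comp_abs (f := φ),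
    integral_const_mul, hmoment]
  norm_num
  field_simp
  exact (sq_sqrt zero_le_two).symm

variable {ι κ : Type*} [Fintype ι] [Fintype κ]

lemma map_sum_mul_stdGaussianPi (w : κ → ℝ) :
    (stdGaussianPi κ).map (fun γ ↦ ∑ k, γ k * w k) =
      gaussianReal 0 (∑ k, w k ^ 2).toNNReal := by
  set v : EuclideanSpace ℝ κ := WithLp.toLp 2 w with hv
  have h := IsGaussian.map_eq_gaussianReal (μ := stdGaussian (EuclideanSpace ℝ κ)) (innerSL ℝ v)
  rw [integral_strongDual_stdGaussian, variance_dual_stdGaussian, innerSL_apply_norm,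
    EuclideanSpace.real_norm_sq_eq, ← map_pi_eq_stdGaussian,
    Measure.map_map (by fun_prop) (by fun_prop)] at h
  convert h using 2
  ext γ
  simp [hv, PiLp.inner_apply]

lemma integrable_sum_mul_stdGaussianPi (w : κ → ℝ) :
    Integrable (fun γ ↦ ∑ k, γ k * w k) (stdGaussianPi κ) :=
  integrable_finsetSum _ fun k _ ↦ .mul_const
    ((measurePreserving_eval (fun _ : κ ↦ gaussianReal 0 1) k).integrable_comp_of_integrable
      (g := id) (memLp_one_iff_integrable.1 (memLp_id_gaussianReal 1))) _

lemma integral_sum_mul_stdGaussianPi (w : κ → ℝ) :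
    ∫ γ, ∑ k, γ k * w k ∂(stdGaussianPi κ) = 0 := by
  have hlin : Measurable fun γ : κ → ℝ ↦ ∑ k, γ k * w k := by fun_prop
  rw [← integral_map (f := fun x : ℝ ↦ x) hlin.aemeasurable (by fun_prop),
    map_sum_mul_stdGaussianPi]
  exact integral_id_gaussianReal

lemma integral_abs_sum_mul_stdGaussianPi (w : κ → ℝ) :
    ∫ γ, |∑ k, γ k * w k| ∂(stdGaussianPi κ) = √(2 / π) * √(∑ k, w k ^ 2) := by
  have hlin : Measurable fun γ : κ → ℝ ↦ ∑ k, γ k * w k := by fun_prop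
  have hscale : gaussianReal 0 (∑ k, w k ^ 2).toNNReal =
      (gaussianReal 0 1).map (fun x ↦ √(∑ k, w k ^ 2) * x) := by
    rw [gaussianReal_map_const_mul]
    congr 1
    · simp
    · ext; simp [sq_sqrt, Finset.sum_nonneg, sq_nonneg]
  rw [← integral_map (f := fun x : ℝ ↦ |x|) hlin.aemeasurable
      continuous_abs.aestronglyMeasurable, map_sum_mul_stdGaussianPi, hscale,
    integral_map (by fun_prop) continuous_abs.aestronglyMeasurable]
  simp only [abs_mul, abs_of_nonneg (sqrt_nonneg _)]
  rw [integral_const_mul, integral_abs_gaussianReal, mul_comm]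

lemma measurePreserving_neg_stdGaussianPi :
    MeasurePreserving (fun γ : κ → ℝ ↦ fun k ↦ -γ k) (stdGaussianPi κ) (stdGaussianPi κ) :=
  measurePreserving_pi _ _ fun _ ↦ ⟨measurable_neg, by simpa using gaussianReal_map_neg (μ := 0)⟩

lemma measurePreserving_curry (μ : Measure ℝ) [IsProbabilityMeasure μ] :
    MeasurePreserving (MeasurableEquiv.curry ι κ ℝ) (.pi fun _ ↦ μ) (.pi fun _ ↦ .pi fun _ ↦ μ) :=
  ⟨(MeasurableEquiv.curry ι κ ℝ).measurable, by
    simpa only [Measure.infinitePi_eq_pi] using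
      Measure.infinitePi_map_curry (fun (_ : ι) (_ : κ) ↦ μ)⟩

end GaussianMoments

section GaussianAverages

lemma extExpectation_mono {Ω : Type*} [MeasurableSpace Ω] {P : Measure Ω} {φ ψ : Ω → EReal}
    (h : ∀ ω, φ ω ≤ ψ ω) : extExpectation P φ ≤ extExpectation P ψ := by
  refine EReal.sub_le_sub (EReal.coe_ennreal_le_coe_ennreal_iff.2 <| lintegral_mono fun ω ↦ ?_)
    (EReal.coe_ennreal_le_coe_ennreal_iff.2 <| lintegral_mono fun ω ↦ ?_)
  · exact EReal.toENNReal_le_toENNReal (h ω)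
  · exact EReal.toENNReal_le_toENNReal (EReal.neg_le_neg_iff.2 (h ω))

lemma extExpectation_coe {Ω : Type*} [MeasurableSpace Ω] {P : Measure Ω} {φ : Ω → ℝ}
    (h : Integrable φ P) : extExpectation P (fun ω ↦ (φ ω : EReal)) = (∫ ω, φ ω ∂P : ℝ) := by
  have hpos : ∫⁻ ω, ENNReal.ofReal (φ ω) ∂P ≠ ⊤ := h.lintegral_lt_top.ne
  have hneg : ∫⁻ ω, ENNReal.ofReal (-φ ω) ∂P ≠ ⊤ := h.neg.lintegral_lt_top.ne
  unfold extExpectation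
  simp only [← EReal.coe_neg, EReal.toENNReal_of_ne_top (EReal.coe_ne_top _), EReal.toReal_coe]
  rw [integral_eq_lintegral_pos_part_sub_lintegral_neg_part h, EReal.coe_sub,
    EReal.coe_ennreal_toReal hpos, EReal.coe_ennreal_toReal hneg]

variable {ι ι' D : Type*} [Fintype ι] [Fintype ι']

lemma extExpectation_comp_equiv {Ω Ω' : Type*} [MeasurableSpace Ω] [MeasurableSpace Ω']
    {P : Measure Ω} {P' : Measure Ω'} {e : Ω ≃ᵐ Ω'} (he : MeasurePreserving e P P')
    (φ : Ω' → EReal) : extExpectation P (fun ω ↦ φ (e ω)) = extExpectation P' φ := by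
  unfold extExpectation
  rw [← he.lintegral_comp_emb e.measurableEmbedding, ← he.lintegral_comp_emb e.measurableEmbedding]

lemma gaussianAverage_range_comp_equiv (e : ι' ≃ ι) (v : D → ι → ℝ) :
    gaussianAverage (Set.range fun d k ↦ v d (e k)) = gaussianAverage (Set.range v) := by
  have he := measurePreserving_piCongrLeft (fun _ : ι ↦ gaussianReal 0 1) e
  unfold gaussianAverage
  rw [← extExpectation_comp_equiv he]
  congr with γ
  simp only [iSup_range]
  congr with d
  rw [← e.sum_comp]
  simp [MeasurableEquiv.coe_piCongrLeft]

lemma integral_iSup_le_gaussianAverage {I : Type*} [Finite I] [Nonempty I]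
    {S : Set (ι → ℝ)} {v : I → ι → ℝ} (hv : ∀ i, v i ∈ S) :
    ((∫ γ, ⨆ i, ∑ k, γ k * v i k ∂(stdGaussianPi ι) : ℝ) : EReal) ≤ gaussianAverage S := by
  rw [← extExpectation_coe (integrable_iSup fun i ↦ integrable_sum_mul_stdGaussianPi (v i))]
  refine extExpectation_mono fun γ ↦ ?_
  obtain ⟨i, hi⟩ := exists_eq_ciSup_of_finite (f := fun i ↦ ∑ k, γ k * v i k)
  rw [← hi]
  exact le_iSup₂_of_le (v i) (hv i) le_rfl

lemma gaussianAverage_nonneg {S : Set (ι → ℝ)} (hS : S.Nonempty) : 0 ≤ gaussianAverage S := by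
  obtain ⟨y, hy⟩ := hS
  simpa [integral_sum_mul_stdGaussianPi] using
    integral_iSup_le_gaussianAverage (I := Unit) (v := fun _ ↦ y) fun _ ↦ hy

variable [Nonempty D] {m : ℕ} {κ : Type*} [Fintype κ]

lemma exists_rademacherAverage_comp_ge [DecidableEq ι] (a : D → ι → ℝ) {r : ℝ} (hr : 0 < r) :
    ∃ i : (ι → ℤˣ) → D, rademacherAverage a ≤ rademacherAverage (fun ε ↦ a (i ε)) + r := by
  have hlt (ε : ι → ℤˣ) : ∃ d, (⨆ d, ∑ t, ε t • a d t) - r < ∑ t, ε t • a d t :=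
    exists_lt_of_lt_ciSup (by linarith)
  choose i hi using hlt
  refine ⟨i, ?_⟩
  unfold rademacherAverage
  rw [← Fintype.expect_const (ι := ι → ℤˣ) r, ← Finset.expect_add_distrib]
  refine Finset.expect_le_expect fun ε _ ↦ ?_
  have hle := le_ciSup (Set.finite_range fun ε' ↦ ∑ t, ε t • a (i ε') t).bddAbove ε
  linarith [hi ε]

lemma coe_rademacherAverage_le_of_finite [DecidableEq ι] {a : D → ι → ℝ} {x : EReal}
    (h : ∀ i : (ι → ℤˣ) → D, ((rademacherAverage (fun ε ↦ a (i ε)) : ℝ) : EReal) ≤ x) :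
    ((rademacherAverage a : ℝ) : EReal) ≤ x := by
  refine EReal.le_of_forall_lt_iff_le.1 fun z hz ↦ EReal.coe_le_coe_iff.2 ?_
  refine le_of_forall_pos_le_add fun r hr ↦ ?_
  obtain ⟨i, hi⟩ := exists_rademacherAverage_comp_ge a hr
  linarith [EReal.coe_lt_coe_iff.1 ((h i).trans_lt hz)]

lemma expect_iSup_add_smul_le_of_abs_sub_le {I : Type*} [Finite I] [Nonempty I] {ψ : I → ℝ}
    {w : I → κ → ℝ} {c : ℝ} (hc : 0 ≤ c)
    (hψ : ∀ i j, |ψ i - ψ j| ≤ c * √(∑ k, (w i k - w j k) ^ 2)) (B : I → ℝ) :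
    𝔼 s : ℤˣ, ⨆ i, (B i + s • ψ i) ≤
      ∫ γ, ⨆ i, (B i + c * √(π / 2) * ∑ k, γ k * w i k) ∂(stdGaussianPi κ) := by
  have hincr (i j : I) : ∫ γ, |c * √(π / 2) * ∑ k, γ k * w i k -
      c * √(π / 2) * ∑ k, γ k * w j k| ∂(stdGaussianPi κ) = c * √(∑ k, (w i k - w j k) ^ 2) := by
    have hone : √(π / 2) * √(2 / π) = 1 := by
      rw [← sqrt_mul (by positivity), div_mul_div_cancel₀ two_ne_zero, div_self pi_ne_zero,
        sqrt_one]
    simp only [← mul_sub, ← Finset.sum_sub_distrib, abs_mul, abs_of_nonneg hc,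
      abs_of_nonneg (sqrt_nonneg _)]
    rw [integral_const_mul, integral_abs_sum_mul_stdGaussianPi fun k ↦ w i k - w j k]
    linear_combination c * √(∑ k, (w i k - w j k) ^ 2) * hone
  rw [expect_intUnits]
  simpa [Units.smul_def, ← sub_eq_add_neg] using iSup_add_iSup_sub_le_integral
    (fun i ↦ (integrable_sum_mul_stdGaussianPi (w i)).const_mul (c * √(π / 2)))
    measurePreserving_neg_stdGaussianPi (fun i γ ↦ by simp) (fun i j ↦ (hincr i j).symm ▸ hψ i j) B

lemma rademacherAverage_le_integral_iSup {I : Type*} [Finite I] [Nonempty I]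
    {a : I → Fin m → ℝ} {v : I → Fin m × κ → ℝ} {c : ℝ} (hc : 0 ≤ c)
    (hav : ∀ i j t, |a i t - a j t| ≤ c * √(∑ k, (v i (t, k) - v j (t, k)) ^ 2)) :
    rademacherAverage a ≤
      c * √(π / 2) * ∫ γ, ⨆ i, ∑ p, γ p * v i p ∂(stdGaussianPi (Fin m × κ)) := by
  have hcompare := expect_iSup_le_integral_iSup
    (fun i t ↦ (integrable_sum_mul_stdGaussianPi fun k ↦ v i (t, k)).const_mul (c * √(π / 2)))
    (fun t ↦ expect_iSup_add_smul_le_of_abs_sub_le hc fun i j ↦ hav i j t) 0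
  rw [← (measurePreserving_curry (gaussianReal 0 1)).integral_comp'] at hcompare
  simp only [Pi.zero_apply, zero_add, ← Finset.mul_sum] at hcompare
  refine hcompare.trans_eq ?_
  simp only [← Real.mul_iSup_of_nonneg (mul_nonneg hc (sqrt_nonneg _)), integral_const_mul,
    Fintype.sum_prod_type]
  rfl

lemma rademacherAverage_le_gaussianAverage {a : D → Fin m → ℝ} {v : D → Fin m × κ → ℝ} {c : ℝ}
    (hc : 0 ≤ c)
    (hav : ∀ d d' t, |a d t - a d' t| ≤ c * √(∑ k, (v d (t, k) - v d' (t, k)) ^ 2)) :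
    ((rademacherAverage a : ℝ) : EReal) ≤
      ((c * √(π / 2) : ℝ) : EReal) * gaussianAverage (Set.range v) := by
  refine coe_rademacherAverage_le_of_finite fun i ↦ ?_
  refine (EReal.coe_le_coe_iff.2 (rademacherAverage_le_integral_iSup hc
    fun ε ε' ↦ hav (i ε) (i ε'))).trans ?_
  rw [EReal.coe_mul (c * √(π / 2))]
  exact mul_le_mul_of_nonneg_left (integral_iSup_le_gaussianAverage fun ε ↦ ⟨i ε, rfl⟩)
    (EReal.coe_nonneg.2 (mul_nonneg hc (sqrt_nonneg _)))

lemma rademacherAverage_le_gaussianAverage_of_abs_sub_le {a v : D → Fin m → ℝ} {c : ℝ}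
    (hc : 0 ≤ c) (hav : ∀ d d' t, |a d t - a d' t| ≤ c * |v d t - v d' t|) :
    ((rademacherAverage a : ℝ) : EReal) ≤
      ((c * √(π / 2) : ℝ) : EReal) * gaussianAverage (Set.range v) := by
  rw [← gaussianAverage_range_comp_equiv (Equiv.prodPUnit.{0} (Fin m))]
  exact rademacherAverage_le_gaussianAverage hc fun d d' t ↦ by
    simpa [sqrt_sq_eq_abs] using hav d d' t

end GaussianAverages

lemma abs_le_of_mem_closure_range {Ω D : Type*} {g : D → Ω → ℝ} {B : ℝ}
    (hB : ∀ d ω, |g d ω| ≤ B) {ψ : Ω → ℝ} (hψ : ψ ∈ closure (Set.range g)) (ω : Ω) : |ψ ω| ≤ B := by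
  have hclosed : IsClosed {φ : Ω → ℝ | |φ ω| ≤ B} :=
    isClosed_le (continuous_apply ω).abs continuous_const
  exact closure_minimal (Set.range_subset_iff.2 fun d ↦ hB d ω) hclosed hψ

section Symmetrization

variable {Ω D ι : Type*} [MeasurableSpace Ω] [Fintype ι] {P : Measure Ω} [IsProbabilityMeasure P]

lemma measurePreserving_pi_prod_pi {κ : ι → Ω × Ω → Ω × Ω}
    (hκ : ∀ i, MeasurePreserving (κ i) (P.prod P) (P.prod P)) :
    MeasurePreserving (fun q : (ι → Ω) × (ι → Ω) ↦
        ((fun i ↦ (κ i (q.1 i, q.2 i)).1 : ι → Ω), (fun i ↦ (κ i (q.1 i, q.2 i)).2 : ι → Ω)))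
      ((Measure.pi fun _ ↦ P).prod (.pi fun _ ↦ P))
      ((Measure.pi fun _ ↦ P).prod (.pi fun _ ↦ P)) := by
  have harrow := measurePreserving_arrowProdEquivProdArrow Ω Ω ι (fun _ ↦ P) (fun _ ↦ P)
  exact (harrow.comp (measurePreserving_pi _ _ hκ)).comp harrow.symm

lemma integral_iSup_sum_smul_sub [Countable D] {g : D → Ω → ℝ} (hg : ∀ d, Measurable (g d))
    (ε : ι → ℤˣ) :
    ∫ q : (ι → Ω) × (ι → Ω), ⨆ d, ∑ i, ε i • (g d (q.1 i) - g d (q.2 i))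
        ∂((Measure.pi fun _ ↦ P).prod (.pi fun _ ↦ P)) =
      ∫ q : (ι → Ω) × (ι → Ω), ⨆ d, ∑ i, (g d (q.1 i) - g d (q.2 i))
        ∂((Measure.pi fun _ ↦ P).prod (.pi fun _ ↦ P)) := by
  let κ (i : ι) : Ω × Ω → Ω × Ω := if ε i = 1 then id else Prod.swap
  have hκ (i : ι) : MeasurePreserving (κ i) (P.prod P) (P.prod P) := by
    by_cases h : ε i = 1
    · simpa only [κ, h, if_true] using .id _
    · simpa only [κ, h, if_false] using Measure.measurePreserving_swap
  have hpi := measurePreserving_pi_prod_pi hκ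
  have hmeas : Measurable fun q : (ι → Ω) × (ι → Ω) ↦ ⨆ d, ∑ i, (g d (q.1 i) - g d (q.2 i)) := by
    fun_prop
  conv_rhs => rw [← hpi.map_eq, integral_map hpi.measurable.aemeasurable hmeas.aestronglyMeasurable]
  congr with q; congr with d; congr with i
  rcases Int.units_eq_one_or (ε i) with h | h <;> simp [κ, h, Units.smul_def]

lemma iSup_sum_smul_sub_le [Nonempty D] {a b : D → ι → ℝ} {B : ℝ} (ha : ∀ d i, |a d i| ≤ B)
    (hb : ∀ d i, |b d i| ≤ B) (ε : ι → ℤˣ) :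
    ⨆ d, ∑ i, ε i • (a d i - b d i) ≤
      (⨆ d, ∑ i, ε i • a d i) + ⨆ d, ∑ i, (-ε) i • b d i := by
  refine ciSup_le fun d ↦ ?_
  refine le_trans (le_of_eq ?_) (add_le_add
    (le_ciSup (bddAbove_range_of_abs_le fun d ↦ abs_sum_intUnits_smul_le ε (ha d)) d)
    (le_ciSup (bddAbove_range_of_abs_le fun d ↦ abs_sum_intUnits_smul_le (-ε) (hb d)) d))
  simp [Units.smul_def, sub_eq_add_neg, Finset.sum_add_distrib]

lemma integrable_iSup_sum_smul [Countable D] [Nonempty D] {a : D → ι → Ω → ℝ}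
    (ham : ∀ d i, Measurable (a d i)) {B : ℝ} (haB : ∀ d i ω, |a d i ω| ≤ B) (ε : ι → ℤˣ) :
    Integrable (fun ω ↦ ⨆ d, ∑ i, ε i • a d i ω) P :=
  integrable_of_abs_le
    (.iSup fun d ↦ Finset.measurable_fun_sum _ fun i _ ↦ (ham d i).const_smul (ε i))
    fun ω ↦ abs_iSup_le fun d ↦ abs_sum_intUnits_smul_le ε fun i ↦ haB d i ω

lemma integral_rademacherAverage [DecidableEq ι] [Countable D] [Nonempty D] {a : D → ι → Ω → ℝ}
    (ham : ∀ d i, Measurable (a d i)) {B : ℝ} (haB : ∀ d i ω, |a d i ω| ≤ B) :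
    ∫ ω, rademacherAverage (fun d i ↦ a d i ω) ∂P =
      𝔼 ε : ι → ℤˣ, ∫ ω, ⨆ d, ∑ i, ε i • a d i ω ∂P := by
  simp only [rademacherAverage, Fintype.expect_eq_sum_div_card]
  rw [integral_div, integral_finsetSum _ fun ε _ ↦ integrable_iSup_sum_smul ham haB ε]

lemma measurable_rademacherAverage [DecidableEq ι] [Countable D] {a : D → ι → Ω → ℝ}
    (ham : ∀ d i, Measurable (a d i)) :
    Measurable fun ω ↦ rademacherAverage fun d i ↦ a d i ω := by
  simp only [rademacherAverage, Fintype.expect_eq_sum_div_card]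
  fun_prop

/-- The maximal deviation of the sums over the sample `Z` of the functions of a family from the
sums over a ghost sample, in expectation over the ghost sample. As the supremum is inside this
expectation, the deviations of all measurable functions in the pointwise closure of the family are
bounded as well, although expectations are not continuous for pointwise convergence along nets. -/
def ghostDeviation (P : Measure Ω) (g : D → Ω → ℝ) (Z : ι → Ω) : ℝ :=
  ∫ Z' : ι → Ω, ⨆ d, ∑ i, (g d (Z' i) - g d (Z i)) ∂(.pi fun _ ↦ P)

lemma measurable_ghostDeviation [Countable D] {g : D → Ω → ℝ} (hg : ∀ d, Measurable (g d)) :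
    Measurable (ghostDeviation P g : (ι → Ω) → ℝ) := by
  have hmeas : Measurable fun q : (ι → Ω) × (ι → Ω) ↦ ⨆ d, ∑ i, (g d (q.2 i) - g d (q.1 i)) := by
    fun_prop
  exact hmeas.stronglyMeasurable.integral_prod_right'.measurable

variable [Countable D] [Nonempty D] {g : D → Ω → ℝ} {B : ℝ}

lemma integrable_iSup_sum_smul_sub (hg : ∀ d, Measurable (g d)) (hB : ∀ d ω, |g d ω| ≤ B)
    (ε : ι → ℤˣ) :
    Integrable (fun q : (ι → Ω) × (ι → Ω) ↦ ⨆ d, ∑ i, ε i • (g d (q.1 i) - g d (q.2 i)))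
      ((Measure.pi fun _ ↦ P).prod (.pi fun _ ↦ P)) :=
  integrable_iSup_sum_smul (B := B + B) (fun d i ↦ by fun_prop)
    (fun d i q ↦ (abs_sub _ _).trans (add_le_add (hB d _) (hB d _))) ε

lemma integrable_ghostDeviation (hg : ∀ d, Measurable (g d)) (hB : ∀ d ω, |g d ω| ≤ B) :
    Integrable (ghostDeviation P g : (ι → Ω) → ℝ) (.pi fun _ ↦ P) := by
  have hone := integrable_iSup_sum_smul_sub (P := P) hg hB (1 : ι → ℤˣ)
  simp only [Pi.one_apply, one_smul] at hone
  exact hone.integral_prod_right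

lemma integral_ghostDeviation_le [DecidableEq ι] (hg : ∀ d, Measurable (g d))
    (hB : ∀ d ω, |g d ω| ≤ B) :
    ∫ Z : ι → Ω, ghostDeviation P g Z ∂(.pi fun _ ↦ P) ≤
      2 * ∫ Z : ι → Ω, rademacherAverage (fun d i ↦ g d (Z i)) ∂(.pi fun _ ↦ P) := by
  set μ := Measure.pi fun _ : ι ↦ P
  let R (ε : ι → ℤˣ) (Z : ι → Ω) : ℝ := ⨆ d, ∑ i, ε i • g d (Z i)
  have hR (ε : ι → ℤˣ) : Integrable (R ε) μ :=
    integrable_iSup_sum_smul (fun d i ↦ (hg d).comp (measurable_pi_apply i))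
      (fun d i Z ↦ hB d (Z i)) ε
  calc ∫ Z : ι → Ω, ghostDeviation P g Z ∂μ
      = ∫ q, ⨆ d, ∑ i, (g d (q.1 i) - g d (q.2 i)) ∂(μ.prod μ) := by
        have hone := integrable_iSup_sum_smul_sub (P := P) hg hB (1 : ι → ℤˣ)
        simp only [Pi.one_apply, one_smul] at hone
        exact (integral_prod_symm _ hone).symm
    _ = 𝔼 ε : ι → ℤˣ, ∫ q, ⨆ d, ∑ i, ε i • (g d (q.1 i) - g d (q.2 i)) ∂(μ.prod μ) := by
        simp only [μ, integral_iSup_sum_smul_sub hg, Fintype.expect_const]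
    _ ≤ 𝔼 ε : ι → ℤˣ, ∫ q, (R ε q.1 + R (-ε) q.2) ∂(μ.prod μ) :=
        Finset.expect_le_expect fun ε _ ↦ integral_mono (integrable_iSup_sum_smul_sub hg hB ε)
          (((hR ε).comp_fst μ).add ((hR (-ε)).comp_snd μ))
          fun q ↦ iSup_sum_smul_sub_le (fun d i ↦ hB d (q.1 i)) (fun d i ↦ hB d (q.2 i)) ε
    _ = 𝔼 ε : ι → ℤˣ, ∫ Z, R ε Z ∂μ + 𝔼 ε : ι → ℤˣ, ∫ Z, R (-ε) Z ∂μ := by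
        rw [← Finset.expect_add_distrib]
        congr with ε
        rw [integral_add ((hR ε).comp_fst μ) ((hR (-ε)).comp_snd μ), integral_fun_fst,
          integral_fun_snd]
        simp
    _ = 2 * 𝔼 ε : ι → ℤˣ, ∫ Z, R ε Z ∂μ := by
        rw [Fintype.expect_equiv (Equiv.neg (ι → ℤˣ)) (fun ε ↦ ∫ Z, R (-ε) Z ∂μ)
          (fun ε ↦ ∫ Z, R ε Z ∂μ) fun ε ↦ rfl, two_mul]
    _ = 2 * ∫ Z, rademacherAverage (fun d i ↦ g d (Z i)) ∂μ := by
        rw [integral_rademacherAverage (a := fun d i (Z : ι → Ω) ↦ g d (Z i))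
          (fun d i ↦ (hg d).comp (measurable_pi_apply i)) fun d i Z ↦ hB d (Z i)]

lemma integrable_iSup_sum_sub (hg : ∀ d, Measurable (g d)) (hB : ∀ d ω, |g d ω| ≤ B)
    (Z : ι → Ω) :
    Integrable (fun Z' : ι → Ω ↦ ⨆ d, ∑ i, (g d (Z' i) - g d (Z i))) (.pi fun _ ↦ P) := by
  simpa using integrable_iSup_sum_smul (B := B + B) (P := .pi fun _ ↦ P)
    (a := fun d i Z' ↦ g d (Z' i) - g d (Z i)) (fun d i ↦ by fun_prop)
    (fun d i Z' ↦ (abs_sub _ _).trans (add_le_add (hB d _) (hB d _))) 1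

lemma card_mul_integral_le_sum_add_ghostDeviation (hg : ∀ d, Measurable (g d))
    (hB : ∀ d ω, |g d ω| ≤ B) {ψ : Ω → ℝ} (hψ : ψ ∈ closure (Set.range g))
    (hψm : Measurable ψ) (Z : ι → Ω) :
    Fintype.card ι * ∫ ω, ψ ω ∂P ≤ ∑ i, ψ (Z i) + ghostDeviation P g Z := by
  have hdev (Z' : ι → Ω) :
      ∑ i, (ψ (Z' i) - ψ (Z i)) ≤ ⨆ d, ∑ i, (g d (Z' i) - g d (Z i)) := by
    have hclosed : IsClosed {φ : Ω → ℝ | ∑ i, (φ (Z' i) - φ (Z i)) ≤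
        ⨆ d, ∑ i, (g d (Z' i) - g d (Z i))} :=
      isClosed_le (by fun_prop) continuous_const
    refine closure_minimal (Set.range_subset_iff.2 fun d ↦ ?_) hclosed hψ
    exact le_ciSup (bddAbove_range_of_abs_le fun d ↦ (Finset.abs_sum_le_sum_abs _ _).trans <|
      Finset.sum_le_sum fun i _ ↦ (abs_sub _ _).trans (add_le_add (hB d (Z' i)) (hB d (Z i)))) d
  have hψint := integrable_of_abs_le (μ := P) hψm (abs_le_of_mem_closure_range hB hψ)
  have hle := integral_mono ((integrable_sum_eval hψint).sub (integrable_const (∑ i, ψ (Z i))))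
    (integrable_iSup_sum_sub (P := P) hg hB Z)
    fun Z' ↦ (Finset.sum_sub_distrib _ _).symm.trans_le (hdev Z')
  rw [integral_sub' (integrable_sum_eval hψint) (integrable_const _), integral_sum_eval hψint,
    integral_const, probReal_univ, one_smul] at hle
  exact sub_le_iff_le_add'.1 hle

lemma integral_integral_le_of_mem_closure [DecidableEq ι]
    (hg : ∀ d, Measurable (g d)) (hB : ∀ d ω, |g d ω| ≤ B) {ψ : (ι → Ω) → Ω → ℝ}
    (hψ : ∀ Z, ψ Z ∈ closure (Set.range g)) (hψm : ∀ Z, Measurable (ψ Z))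
    (hψ0 : ∀ Z ω, 0 ≤ ψ Z ω)
    (hψs : Integrable (fun Z ↦ ∑ i, ψ Z (Z i)) (.pi fun _ ↦ P)) :
    Fintype.card ι * ∫ Z, ∫ ω, ψ Z ω ∂P ∂(.pi fun _ ↦ P) ≤
      (∫ Z, ∑ i, ψ Z (Z i) ∂(.pi fun _ ↦ P)) +
        2 * ∫ Z : ι → Ω, rademacherAverage (fun d i ↦ g d (Z i)) ∂(.pi fun _ ↦ P) := by
  have hghost : Integrable (ghostDeviation P g) (.pi fun _ : ι ↦ P) :=
    integrable_ghostDeviation hg hB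
  rw [← integral_const_mul]
  refine (integral_mono_of_nonneg
    (.of_forall fun Z ↦ mul_nonneg (Nat.cast_nonneg _) (integral_nonneg (hψ0 Z)))
    (hψs.add hghost) (.of_forall fun Z ↦
      card_mul_integral_le_sum_add_ghostDeviation hg hB (hψ Z) (hψm Z) Z)).trans ?_
  rw [integral_add' hψs hghost]
  gcongr
  exact integral_ghostDeviation_le hg hB

end Symmetrization

section BoundedDeviations

variable {Ω D ι : Type*} [DecidableEq ι] [Fintype ι] [Nonempty D] {g : D → Ω → ℝ}
  {B : ℝ} {c : ℝ≥0}

lemma hasBoundedDifferences_rademacherAverage (hB : ∀ d ω, |g d ω| ≤ B)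
    (hc : ∀ d x y, |g d x - g d y| ≤ c) :
    HasBoundedDifferences (fun Z : ι → Ω ↦ rademacherAverage fun d i ↦ g d (Z i)) fun _ ↦ c := by
  intro Z i x y
  refine (abs_rademacherAverage_sub_le (fun d _ ↦ hB d _) (fun d _ ↦ hB d _)
    (c := Pi.single i (c : ℝ)) fun d j ↦ ?_).trans_eq (Fintype.sum_pi_single' i _)
  obtain rfl | hj := eq_or_ne j i
  · simpa using hc d x y
  · simp [hj]
variable [MeasurableSpace Ω] {P : Measure Ω} [IsProbabilityMeasure P]

lemma hasBoundedDifferences_ghostDeviation [Countable D] (hg : ∀ d, Measurable (g d))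
    (hB : ∀ d ω, |g d ω| ≤ B) (hc : ∀ d x y, |g d x - g d y| ≤ c) :
    HasBoundedDifferences (ghostDeviation P g : (ι → Ω) → ℝ) fun _ ↦ c := by
  refine .integral (integrable_iSup_sum_sub hg hB) fun Z' ↦ .iSup (fun Z ↦ ?_) fun d ↦ ?_
  · exact bddAbove_range_of_abs_le fun d ↦ (Finset.abs_sum_le_sum_abs _ _).trans <|
      Finset.sum_le_sum fun i _ ↦ (abs_sub _ _).trans (add_le_add (hB d (Z' i)) (hB d (Z i)))
  · refine hasBoundedDifferences_sum (φ := fun i x ↦ g d (Z' i) - g d x) fun i x y ↦ ?_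
    rw [sub_sub_sub_cancel_left, abs_sub_comm]
    exact hc d x y

end BoundedDeviations

section EmpiricalMinimization

variable {Ω D : Type*} {g : D → Ω → ℝ} {m : ℕ}

lemma hasBoundedDifferences_iInf_sum [Nonempty D]
    (hg01 : ∀ d ω, g d ω ∈ Set.Icc (0 : ℝ) 1) :
    HasBoundedDifferences (fun Z : Fin m → Ω ↦ ⨅ d, ∑ i, g d (Z i)) fun _ ↦ 1 :=
  .iInf (fun Z ↦ ⟨0, Set.forall_mem_range.2 fun d ↦ Finset.sum_nonneg fun i _ ↦ (hg01 d (Z i)).1⟩)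
    fun d ↦ hasBoundedDifferences_sum (φ := fun _ ↦ g d) fun _ x y ↦
      Real.dist_le_of_mem_Icc_01 (hg01 d x) (hg01 d y)

variable [MeasurableSpace Ω] {P : Measure Ω} [IsProbabilityMeasure P]

lemma integral_iInf_sum_le (hg01 : ∀ d ω, g d ω ∈ Set.Icc (0 : ℝ) 1) {ψ : Ω → ℝ}
    (hψ : ψ ∈ closure (Set.range g)) (hψm : Measurable ψ) :
    ∫ Z : Fin m → Ω, ⨅ d, ∑ i, g d (Z i) ∂(.pi fun _ ↦ P) ≤ m * ∫ ω, ψ ω ∂P := by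
  have hnonneg (Z : Fin m → Ω) (d : D) : 0 ≤ ∑ i, g d (Z i) :=
    Finset.sum_nonneg fun i _ ↦ (hg01 d _).1
  have hint : Integrable ψ P := integrable_of_abs_le hψm
    (abs_le_of_mem_closure_range (fun d ω ↦ abs_le_one_of_mem_Icc (hg01 d ω)) hψ)
  have hle (Z : Fin m → Ω) : ⨅ d, ∑ i, g d (Z i) ≤ ∑ i, ψ (Z i) := by
    have hclosed : IsClosed {φ : Ω → ℝ | ⨅ d, ∑ i, g d (Z i) ≤ ∑ i, φ (Z i)} :=
      isClosed_le continuous_const (by fun_prop)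
    refine closure_minimal (Set.range_subset_iff.2 fun d ↦ ?_) hclosed hψ
    exact ciInf_le ⟨0, Set.forall_mem_range.2 (hnonneg Z)⟩ d
  calc ∫ Z : Fin m → Ω, ⨅ d, ∑ i, g d (Z i) ∂(.pi fun _ ↦ P)
      ≤ ∫ Z : Fin m → Ω, ∑ i, ψ (Z i) ∂(.pi fun _ ↦ P) :=
        integral_mono_of_nonneg (.of_forall fun Z ↦ Real.iInf_nonneg (hnonneg Z))
          (integrable_sum_eval hint) (.of_forall hle)
    _ = m * ∫ ω, ψ ω ∂P := by rw [integral_sum_eval hint, Fintype.card_fin]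

variable [Countable D] [Nonempty D]

theorem withProbAtLeast_ghostDeviation_add_le (hm : 0 < m) (hg : ∀ d, Measurable (g d))
    (hg01 : ∀ d ω, g d ω ∈ Set.Icc (0 : ℝ) 1) {A : (Fin m → Ω) → ℝ} {b : ℝ≥0} (hA : Measurable A)
    (hAb : HasBoundedDifferences A fun _ ↦ b) {δ : ℝ} (hδ : 0 < δ) :
    WithProbAtLeast (.pi fun _ : Fin m ↦ P) δ fun Z ↦
      ghostDeviation P g Z + (⨅ d, ∑ i, g d (Z i)) + ∫ Z', A Z' ∂(.pi fun _ ↦ P) ≤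
        (∫ Z' : Fin m → Ω, ⨅ d, ∑ i, g d (Z' i) ∂(.pi fun _ ↦ P)) +
          2 * rademacherAverage (fun d i ↦ g d (Z i)) + A Z + (4 + b) * √(m * log (1 / δ) / 2) := by
  have hB (d) (ω) : |g d ω| ≤ 1 := abs_le_one_of_mem_Icc (hg01 d ω)
  have hosc (d x y) : |g d x - g d y| ≤ (1 : ℝ≥0) :=
    Real.dist_le_of_mem_Icc_01 (hg01 d x) (hg01 d y)
  let R (Z : Fin m → Ω) : ℝ := rademacherAverage fun d i ↦ g d (Z i)
  let M (Z : Fin m → Ω) : ℝ := ⨅ d, ∑ i, g d (Z i)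
  have hRm : Measurable R :=
    measurable_rademacherAverage fun d i ↦ (hg d).comp (measurable_pi_apply i)
  have hRb : HasBoundedDifferences R fun _ ↦ 1 := hasBoundedDifferences_rademacherAverage hB hosc
  have hMm : Measurable M := by fun_prop
  have hMb : HasBoundedDifferences M fun _ ↦ 1 := hasBoundedDifferences_iInf_sum hg01
  have hGm := measurable_ghostDeviation (ι := Fin m) (P := P) hg
  have hGb := hasBoundedDifferences_ghostDeviation (ι := Fin m) (P := P) hg hB hosc
  have hWb : HasBoundedDifferences
      (fun Z ↦ ghostDeviation P g Z + M Z - (2 * R Z + A Z)) fun _ ↦ 4 + b := by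
    convert (hGb.add hMb).sub ((hRb.const_mul 2).add hAb) using 1
    ext i
    norm_num [← add_assoc]
  have hmean : ∫ Z, (ghostDeviation P g Z + M Z - (2 * R Z + A Z)) ∂(.pi fun _ ↦ P) ≤
      (∫ Z, M Z ∂(.pi fun _ ↦ P)) - ∫ Z, A Z ∂(.pi fun _ ↦ P) := by
    have hGi := hGb.integrable (μ := .pi fun _ ↦ P) hGm
    have hMi := hMb.integrable (μ := .pi fun _ ↦ P) hMm
    have hRi := (hRb.integrable (μ := .pi fun _ ↦ P) hRm).const_mul 2
    have hAi := hAb.integrable (μ := .pi fun _ ↦ P) hA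
    have hGMi : Integrable (fun Z ↦ ghostDeviation P g Z + M Z) (.pi fun _ ↦ P) := hGi.add hMi
    have hRAi : Integrable (fun Z ↦ 2 * R Z + A Z) (.pi fun _ ↦ P) := hRi.add hAi
    rw [integral_sub hGMi hRAi, integral_add hGi hMi, integral_add hRi hAi, integral_const_mul]
    linarith [integral_ghostDeviation_le (ι := Fin m) (P := P) hg hB]
  refine (hWb.withProbAtLeast hm (by positivity) (by fun_prop) hδ (P := P)).mono fun Z hZ ↦ ?_
  push_cast at hZ
  linarith

theorem withProbAtLeast_integral_le_of_isMin (hm : 0 < m) (hg : ∀ d, Measurable (g d))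
    (hg01 : ∀ d ω, g d ω ∈ Set.Icc (0 : ℝ) 1) {A : (Fin m → Ω) → ℝ} {b : ℝ≥0} (hA : Measurable A)
    (hAb : HasBoundedDifferences A fun _ ↦ b) {δ : ℝ} (hδ : 0 < δ) :
    WithProbAtLeast (.pi fun _ : Fin m ↦ P) δ fun Z ↦ ∀ ψ ∈ closure (Set.range g), Measurable ψ →
      (∀ d, ∑ i, ψ (Z i) ≤ ∑ i, g d (Z i)) → ∀ φ ∈ closure (Set.range g), Measurable φ →
      m * (∫ ω, ψ ω ∂P) + ∫ Z', A Z' ∂(.pi fun _ ↦ P) ≤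
        m * (∫ ω, φ ω ∂P) + 2 * rademacherAverage (fun d i ↦ g d (Z i)) + A Z +
          (4 + b) * √(m * log (1 / δ) / 2) := by
  refine (withProbAtLeast_ghostDeviation_add_le hm hg hg01 hA hAb hδ).mono
    fun Z hZ ψ hψ hψm hmin φ hφ hφm ↦ ?_
  have hdev := card_mul_integral_le_sum_add_ghostDeviation (P := P) hg
    (fun d ω ↦ abs_le_one_of_mem_Icc (hg01 d ω)) hψ hψm Z
  rw [Fintype.card_fin] at hdev
  linarith [hZ, le_ciInf hmin, integral_iInf_sum_le (m := m) (P := P) hg01 hφ hφm]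

end EmpiricalMinimization

section Environment

variable {Ω : Type*} [MeasurableSpace Ω]

lemma measurable_pi_probabilityMeasure (n : ℕ) :
    Measurable fun μ : ProbabilityMeasure Ω ↦ Measure.pi fun _ : Fin n ↦ (μ : Measure Ω) := by
  refine Measurable.measure_of_isPiSystem_of_isProbabilityMeasure generateFrom_pi.symm
    isPiSystem_pi ?_
  rintro _ ⟨s, hs, rfl⟩
  simp only [Measure.pi_pi]
  exact Finset.measurable_fun_prod _ fun i _ ↦
    (Measure.measurable_coe (hs i trivial)).comp measurable_subtype_coe

/-- The law `μ ^ n` of an `n`-sample of the task `μ`, as a Markov kernel. -/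
def sampleKernel (Ω : Type*) [MeasurableSpace Ω] (n : ℕ) :
    Kernel (ProbabilityMeasure Ω) (Fin n → Ω) where
  toFun μ := .pi fun _ ↦ (μ : Measure Ω)
  measurable' := measurable_pi_probabilityMeasure n

/-- The law `μ` of an observation of the task `μ`, as a Markov kernel. -/
def taskKernel (Ω : Type*) [MeasurableSpace Ω] : Kernel (ProbabilityMeasure Ω) Ω where
  toFun μ := μ
  measurable' := measurable_subtype_coe

instance (n : ℕ) : IsMarkovKernel (sampleKernel Ω n) :=
  ⟨fun μ ↦ inferInstanceAs (IsProbabilityMeasure (.pi fun _ : Fin n ↦ (μ : Measure Ω)))⟩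

instance : IsMarkovKernel (taskKernel Ω) :=
  ⟨fun μ ↦ inferInstanceAs (IsProbabilityMeasure (μ : Measure Ω))⟩

lemma measurable_iInf_integral {D : Type*} [Countable D] {g : D → Ω → ℝ}
    (hg : ∀ d, Measurable (g d)) :
    Measurable fun μ : ProbabilityMeasure Ω ↦ ⨅ d, ∫ ω, g d ω ∂(μ : Measure Ω) :=
  .iInf fun d ↦ ((hg d).stronglyMeasurable.integral_kernel (κ := taskKernel Ω)).measurable

variable {X : Type*} [MeasurableSpace X] {n : ℕ} {η : Measure (ProbabilityMeasure (X × ℝ))}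

instance [IsProbabilityMeasure η] : IsProbabilityMeasure (sampleLaw n η) :=
  inferInstanceAs (IsProbabilityMeasure (η.bind (sampleKernel (X × ℝ) n)))

variable {f : (Fin n → X × ℝ) → ℝ}

lemma integrable_integral_pi (hf : Integrable f (sampleLaw n η)) :
    Integrable (fun μ : ProbabilityMeasure (X × ℝ) ↦
      ∫ z, f z ∂(.pi fun _ : Fin n ↦ (μ : Measure (X × ℝ)))) η := by
  change Integrable f (sampleKernel (X × ℝ) n ∘ₘ η) at hf
  rw [Measure.comp_eq_comp_const_apply] at hf
  exact hf.integral_comp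

lemma integral_sampleLaw (hf : Integrable f (sampleLaw n η)) :
    ∫ z, f z ∂(sampleLaw n η) = ∫ μ, ∫ z, f z ∂(.pi fun _ : Fin n ↦ (μ : Measure (X × ℝ))) ∂η := by
  change Integrable f (sampleKernel (X × ℝ) n ∘ₘ η) at hf
  change ∫ z, f z ∂(sampleKernel (X × ℝ) n ∘ₘ η) = _
  rw [Measure.comp_eq_comp_const_apply] at hf ⊢
  exact Kernel.integral_comp hf

lemma lintegral_sum_sampleLaw {φ : X × ℝ → ℝ≥0∞} (hφ : Measurable φ) :
    ∫⁻ z, ∑ i, φ (z i) ∂(sampleLaw n η) = n * ∫⁻ p, φ p ∂(mixture η) := by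
  have hφi (i : Fin n) : Measurable fun z : Fin n → X × ℝ ↦ φ (z i) :=
    hφ.comp (measurable_pi_apply i)
  calc ∫⁻ z, ∑ i, φ (z i) ∂(sampleLaw n η)
      = ∫⁻ μ, ∫⁻ z, ∑ i, φ (z i) ∂(.pi fun _ : Fin n ↦ (μ : Measure (X × ℝ))) ∂η :=
        Measure.lintegral_bind (measurable_pi_probabilityMeasure n).aemeasurable
          (Finset.measurable_fun_sum _ fun i _ ↦ hφi i).aemeasurable
    _ = ∫⁻ μ, n * ∫⁻ p, φ p ∂(μ : Measure (X × ℝ)) ∂η := by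
        refine lintegral_congr fun μ ↦ ?_
        rw [lintegral_finsetSum _ fun i _ ↦ hφi i]
        simp [(measurePreserving_eval (fun _ : Fin n ↦ (μ : Measure (X × ℝ))) _).lintegral_comp hφ]
    _ = n * ∫⁻ p, φ p ∂(mixture η) := by
        rw [lintegral_const_mul' _ _ (ENNReal.natCast_ne_top n)]
        exact congr_arg _ (Measure.lintegral_bind measurable_subtype_coe.aemeasurable
          hφ.aemeasurable).symm

variable [IsProbabilityMeasure η] {D : Type*} [Countable D] {g : D → X × ℝ → ℝ}
  {ψ : (Fin n → X × ℝ) → X × ℝ → ℝ}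

lemma integral_risk_le_of_mem_closure [Nonempty D] (hg : ∀ d, Measurable (g d)) {B : ℝ}
    (hB : ∀ d p, |g d p| ≤ B) (hψ : ∀ z, ψ z ∈ closure (Set.range g))
    (hψm : ∀ z, Measurable (ψ z)) (hψ0 : ∀ z p, 0 ≤ ψ z p)
    (hψs : Measurable fun z ↦ ∑ i, ψ z (z i)) :
    n * ∫ μ, ∫ z, ∫ p, ψ z p ∂(μ : Measure (X × ℝ))
        ∂(.pi fun _ : Fin n ↦ (μ : Measure (X × ℝ))) ∂η ≤
      (∫ z, ∑ i, ψ z (z i) ∂(sampleLaw n η)) +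
        2 * ∫ z, rademacherAverage (fun d i ↦ g d (z i)) ∂(sampleLaw n η) := by
  have hψB (z : Fin n → X × ℝ) : |∑ i, ψ z (z i)| ≤ n * B := by
    refine (Finset.abs_sum_le_sum_abs _ _).trans ((Finset.sum_le_card_nsmul _ _ B fun i _ ↦
      abs_le_of_mem_closure_range hB (hψ z) _).trans_eq ?_)
    simp
  have hψi {P : Measure (Fin n → X × ℝ)} [IsProbabilityMeasure P] :
      Integrable (fun z ↦ ∑ i, ψ z (z i)) P := integrable_of_abs_le hψs hψB
  have hR : Integrable (fun z ↦ rademacherAverage fun d i ↦ g d (z i)) (sampleLaw n η) :=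
    integrable_of_abs_le
      (measurable_rademacherAverage fun d i ↦ (hg d).comp (measurable_pi_apply i))
      fun z ↦ abs_rademacherAverage_le fun d i ↦ hB d (z i)
  rw [integral_sampleLaw hψi, integral_sampleLaw hR, ← integral_const_mul, ← integral_const_mul,
    ← integral_add (integrable_integral_pi hψi) ((integrable_integral_pi hR).const_mul 2)]
  refine integral_mono_of_nonneg (.of_forall fun μ ↦ ?_)
    ((integrable_integral_pi hψi).add ((integrable_integral_pi hR).const_mul 2))
    (.of_forall fun μ ↦ ?_)
  · exact mul_nonneg n.cast_nonneg (integral_nonneg fun z ↦ integral_nonneg (hψ0 z))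
  · simpa only [Fintype.card_fin] using
      integral_integral_le_of_mem_closure (P := (μ : Measure (X × ℝ))) hg hB hψ hψm hψ0 hψi

lemma integral_sampleLaw_le_integral_iInf [Nonempty D] (hg : ∀ d, Measurable (g d)) {B : ℝ}
    (hB : ∀ d p, |g d p| ≤ B) {φ : (Fin n → X × ℝ) → ℝ} (hφi : Integrable φ (sampleLaw n η))
    (hφ0 : ∀ z, 0 ≤ φ z) (hφ : ∀ z d, φ z ≤ ∑ i, g d (z i)) :
    ∫ z, φ z ∂(sampleLaw n η) ≤ n * ∫ μ, ⨅ d, ∫ p, g d p ∂(μ : Measure (X × ℝ)) ∂η := by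
  have hgi (d) (μ : ProbabilityMeasure (X × ℝ)) : Integrable (g d) (μ : Measure (X × ℝ)) :=
    integrable_of_abs_le (hg d) (hB d)
  have hinf : Integrable (fun μ : ProbabilityMeasure (X × ℝ) ↦
      ⨅ d, ∫ p, g d p ∂(μ : Measure (X × ℝ))) η :=
    integrable_of_abs_le (B := B) (measurable_iInf_integral hg) fun μ ↦ abs_iInf_le fun d ↦ by
      simpa using norm_integral_le_of_norm_le_const (f := g d) (μ := (μ : Measure (X × ℝ)))
        (.of_forall (hB d))
  rw [integral_sampleLaw hφi, ← integral_const_mul]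
  refine integral_mono_of_nonneg (.of_forall fun μ ↦ integral_nonneg hφ0) (hinf.const_mul _)
    (.of_forall fun μ ↦ ?_)
  simp only
  rw [Real.mul_iInf_of_nonneg n.cast_nonneg]
  refine le_ciInf fun d ↦ ?_
  refine (integral_mono_of_nonneg (.of_forall hφ0) (integrable_sum_eval (hgi d μ))
    (.of_forall fun z ↦ hφ z d)).trans_eq ?_
  rw [integral_sum_eval (hgi d μ), Fintype.card_fin]

end Environment

section Separability

lemma exists_seq_subset_seqClosure_range {E Y : Type*} [TopologicalSpace E] [TopologicalSpace Y]
    [SecondCountableTopology E] [LocallyCompactSpace E] [SecondCountableTopology Y]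
    {F : Set (E → Y)} (hF : ∀ f ∈ F, Continuous f) (hne : F.Nonempty) :
    ∃ u : ℕ → E → Y, (∀ k, u k ∈ F) ∧ F ⊆ seqClosure (Set.range u) := by
  let S : Set C(E, Y) := {f | ⇑f ∈ F}
  obtain ⟨f₀, hf₀⟩ := hne
  have : Nonempty S := ⟨⟨⟨f₀, hF f₀ hf₀⟩, hf₀⟩⟩
  have : SecondCountableTopology S := TopologicalSpace.Subtype.secondCountableTopology S
  let u := TopologicalSpace.denseSeq S
  refine ⟨fun k ↦ u k, fun k ↦ (u k).2, fun f hf ↦ ?_⟩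
  obtain ⟨x, hx, hlim⟩ := mem_closure_iff_seq_limit.1
    (TopologicalSpace.denseRange_denseSeq S ⟨⟨f, hF f hf⟩, hf⟩)
  refine ⟨fun j ↦ x j, fun j ↦ ?_, tendsto_pi_nhds.2 fun v ↦ ?_⟩
  · obtain ⟨k, hk⟩ := hx j
    exact ⟨k, by simp only [u, hk]⟩
  · have hcont : Continuous fun g : S ↦ g.1 v :=
      (ContinuousEvalConst.continuous_eval_const v).comp continuous_subtype_val
    exact (hcont.tendsto _).comp hlim

lemma comp_mem_seqClosure_range {α β γ D : Type*} [TopologicalSpace β] [TopologicalSpace γ]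
    {E : Type*} {u : D → E → β} {f : E → β} (hf : f ∈ seqClosure (Set.range u)) (x : α → E)
    {φ : α → β → γ} (hφ : ∀ a, Continuous (φ a)) :
    (fun a ↦ φ a (f (x a))) ∈ seqClosure (Set.range fun k a ↦ φ a (u k (x a))) := by
  obtain ⟨w, hw, hlim⟩ := hf
  choose k hk using hw
  refine ⟨fun j a ↦ φ a (w j (x a)), fun j ↦ ⟨k j, by simp only [hk]⟩,
    tendsto_pi_nhds.2 fun a ↦ ?_⟩
  exact ((hφ a).tendsto _).comp (tendsto_pi_nhds.1 hlim (x a))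

lemma iInf_integral_eq_iInf_integral_comp {Ω I D : Type*} [MeasurableSpace Ω] [Nonempty D]
    {P : Measure Ω} [IsProbabilityMeasure P] {g : I → Ω → ℝ} (hg : ∀ i, Measurable (g i)) {B : ℝ}
    (hB : ∀ i ω, |g i ω| ≤ B) {u : D → I} (hu : ∀ i, g i ∈ seqClosure (Set.range (g ∘ u))) :
    ⨅ i, ∫ ω, g i ω ∂P = ⨅ k, ∫ ω, g (u k) ω ∂P := by
  have : Nonempty I := .map u inferInstance
  have hint (i : I) : |∫ ω, g i ω ∂P| ≤ B := by
    simpa using norm_integral_le_of_norm_le_const (μ := P) (f := g i) (.of_forall (hB i))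
  refine le_antisymm (le_ciInf fun k ↦ ciInf_le (bddBelow_range_of_abs_le hint) (u k))
    (le_ciInf fun i ↦ ?_)
  obtain ⟨w, hw, hlim⟩ := hu i
  choose k hk using hw
  have htendsto : Tendsto (fun j ↦ ∫ ω, g (u (k j)) ω ∂P) atTop (𝓝 (∫ ω, g i ω ∂P)) := by
    refine tendsto_integral_of_dominated_convergence (fun _ ↦ B)
      (fun j ↦ (hg _).aestronglyMeasurable) (integrable_const B)
      (fun j ↦ .of_forall (hB _)) (.of_forall fun ω ↦ ?_)
    simpa only [← hk, comp_apply] using tendsto_pi_nhds.1 hlim ω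
  exact ge_of_tendsto' htendsto fun j ↦
    ciInf_le (bddBelow_range_of_abs_le fun k ↦ hint (u k)) (k j)

end Separability

section Risks

lemma continuous_of_abs_sub_le_mul_sum {A ι E : Type*} [TopologicalSpace A] [Fintype ι]
    [SeminormedAddCommGroup E] {f : A → ℝ} {v : A → ι → E} (hv : Continuous v) (c : ℝ)
    (hf : ∀ a b, |f a - f b| ≤ c * ∑ i, ‖v a i - v b i‖) : Continuous f := by
  refine continuous_iff_continuousAt.2 fun b ↦ tendsto_iff_dist_tendsto_zero.2 ?_
  have hc : Continuous fun a ↦ c * ∑ i, ‖v a i - v b i‖ := by fun_prop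
  exact squeeze_zero (fun _ ↦ dist_nonneg) (hf · b) (by simpa using hc.tendsto b)

/-- A measurable loss with values in `[0, 1]` that is `1`-Lipschitz in the prediction. -/
structure IsLipschitzLoss (l : ℝ → ℝ → ℝ) : Prop where
  measurable : Measurable fun p : ℝ × ℝ ↦ l p.1 p.2
  mem_Icc : ∀ u y, l u y ∈ Set.Icc (0 : ℝ) 1
  lipschitz : ∀ y, LipschitzWith 1 fun u ↦ l u y

variable {X : Type*} {K T n : ℕ} {l : ℝ → ℝ → ℝ} {H : Set (X → EuclideanSpace ℝ (Fin K))}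
  {F : Set (EuclideanSpace ℝ (Fin K) → ℝ)} {L : ℝ≥0}
  {fhat : (X → EuclideanSpace ℝ (Fin K)) → (Fin n → X × ℝ) → EuclideanSpace ℝ (Fin K) → ℝ}
  {h h' : X → EuclideanSpace ℝ (Fin K)}

/-- The risk on the sample `z` of the representation `h`, specialized to `z` by `fhat`. It is the
minimal empirical risk over `F` if `fhat` minimizes the empirical risk. -/
def minRisk (l : ℝ → ℝ → ℝ)
    (fhat : (X → EuclideanSpace ℝ (Fin K)) → (Fin n → X × ℝ) → EuclideanSpace ℝ (Fin K) → ℝ)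
    (h : X → EuclideanSpace ℝ (Fin K)) (z : Fin n → X × ℝ) : ℝ :=
  empiricalRisk l z h (fhat h z)

lemma card_mul_empiricalRisk (hn : 0 < n) (z : Fin n → X × ℝ)
    (f : EuclideanSpace ℝ (Fin K) → ℝ) :
    n * empiricalRisk l z h f = ∑ i, l (f (h (z i).1)) (z i).2 := by
  have : (n : ℝ) ≠ 0 := by positivity
  rw [empiricalRisk, ← mul_assoc, mul_one_div_cancel this, one_mul]

lemma empiricalRisk_mem_Icc (hl : ∀ u y, l u y ∈ Set.Icc (0 : ℝ) 1) (z : Fin n → X × ℝ)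
    (f : EuclideanSpace ℝ (Fin K) → ℝ) : empiricalRisk l z h f ∈ Set.Icc (0 : ℝ) 1 := by
  refine ⟨mul_nonneg (by positivity) (Finset.sum_nonneg fun i _ ↦ (hl _ _).1), ?_⟩
  rw [empiricalRisk, one_div_mul_eq_div]
  refine div_le_one_of_le₀ ?_ n.cast_nonneg
  simpa using Finset.sum_le_card_nsmul Finset.univ (fun i ↦ l (f (h (z i).1)) (z i).2) 1
    fun i _ ↦ (hl _ _).2

lemma multitaskRisk_eq_sum_empiricalRisk (Z : Fin T → Fin n → X × ℝ)
    (f : Fin T → EuclideanSpace ℝ (Fin K) → ℝ) :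
    multitaskRisk l Z h f = (1 / (T : ℝ)) * ∑ t, empiricalRisk l (Z t) h (f t) := by
  unfold multitaskRisk empiricalRisk
  rw [← Finset.mul_sum, ← mul_assoc, one_div_mul_one_div, mul_comm (T : ℝ)]

lemma sum_minRisk_le_of_isMTRLSolution (hT : 0 < T) (hfhat : IsEmpiricalMinimizer l H F fhat)
    {Z : Fin T → Fin n → X × ℝ} (hsol : IsMTRLSolution l H F Z h) (hh' : h' ∈ H) :
    ∑ t, minRisk l fhat h (Z t) ≤ ∑ t, minRisk l fhat h' (Z t) := by
  obtain ⟨hh, f, hf, hmin⟩ := hsol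
  have hle := hmin h' hh' (fun t ↦ fhat h' (Z t)) fun t ↦ (hfhat h' hh' (Z t)).1
  rw [multitaskRisk_eq_sum_empiricalRisk, multitaskRisk_eq_sum_empiricalRisk,
    mul_le_mul_iff_right₀ (by positivity)] at hle
  exact (Finset.sum_le_sum fun t _ ↦ (hfhat h hh (Z t)).2 _ (hf t)).trans hle

lemma abs_loss_comp_sub_le (hl : ∀ y, LipschitzWith 1 fun u ↦ l u y)
    {f : EuclideanSpace ℝ (Fin K) → ℝ} (hf : LipschitzWith L f) (x y : EuclideanSpace ℝ (Fin K))
    (w : ℝ) : |l (f x) w - l (f y) w| ≤ L * ‖x - y‖ := by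
  simpa [Real.dist_eq, dist_eq_norm] using ((hl w).comp hf).dist_le_mul x y

lemma abs_empiricalRisk_sub_le (hl : ∀ y, LipschitzWith 1 fun u ↦ l u y)
    {f : EuclideanSpace ℝ (Fin K) → ℝ} (hf : LipschitzWith L f) (z : Fin n → X × ℝ) :
    |empiricalRisk l z h f - empiricalRisk l z h' f| ≤
      (L / n) * ∑ i, ‖h (z i).1 - h' (z i).1‖ := by
  unfold empiricalRisk
  rw [← mul_sub, ← Finset.sum_sub_distrib, abs_mul, abs_of_nonneg (by positivity),
    div_eq_mul_one_div (L : ℝ), mul_comm (L : ℝ), mul_assoc, Finset.mul_sum _ _ (L : ℝ)]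
  exact mul_le_mul_of_nonneg_left ((Finset.abs_sum_le_sum_abs _ _).trans
    (Finset.sum_le_sum fun i _ ↦ abs_loss_comp_sub_le hl hf _ _ _)) (by positivity)

lemma abs_minRisk_sub_le (hl : ∀ y, LipschitzWith 1 fun u ↦ l u y)
    (hF : ∀ f ∈ F, LipschitzWith L f) (hfhat : IsEmpiricalMinimizer l H F fhat)
    (hh : h ∈ H) (hh' : h' ∈ H) (z : Fin n → X × ℝ) :
    |minRisk l fhat h z - minRisk l fhat h' z| ≤ (L / n) * ∑ i, ‖h (z i).1 - h' (z i).1‖ := by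
  have hle := (hfhat h hh z).2 _ (hfhat h' hh' z).1
  have hge := (hfhat h' hh' z).2 _ (hfhat h hh z).1
  have hdiff := abs_le.1 (abs_empiricalRisk_sub_le (h := h) (h' := h') hl
    (hF _ (hfhat h hh z).1) z)
  have hdiff' := abs_le.1 (abs_empiricalRisk_sub_le (h := h) (h' := h') hl
    (hF _ (hfhat h' hh' z).1) z)
  unfold minRisk
  exact abs_le.2 ⟨by linarith, by linarith⟩

lemma abs_minRisk_sub_le_sqrt (hl : ∀ y, LipschitzWith 1 fun u ↦ l u y)
    (hF : ∀ f ∈ F, LipschitzWith L f) (hfhat : IsEmpiricalMinimizer l H F fhat)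
    (hh : h ∈ H) (hh' : h' ∈ H) (z : Fin n → X × ℝ) :
    |minRisk l fhat h z - minRisk l fhat h' z| ≤
      (L / √n) * √(∑ p : Fin n × Fin K, (h (z p.1).1 p.2 - h' (z p.1).1 p.2) ^ 2) := by
  have hsq : ∑ p : Fin n × Fin K, (h (z p.1).1 p.2 - h' (z p.1).1 p.2) ^ 2 =
      ∑ i, ‖h (z i).1 - h' (z i).1‖ ^ 2 := by
    rw [Fintype.sum_prod_type]
    simp [EuclideanSpace.real_norm_sq_eq]
  have hcauchy : ∑ i, ‖h (z i).1 - h' (z i).1‖ ≤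
      √n * √(∑ i, ‖h (z i).1 - h' (z i).1‖ ^ 2) := by
    rw [← sqrt_mul n.cast_nonneg]
    refine le_sqrt_of_sq_le ?_
    simpa using sq_sum_le_card_mul_sum_sq (s := Finset.univ)
      (f := fun i ↦ ‖h (z i).1 - h' (z i).1‖)
  calc |minRisk l fhat h z - minRisk l fhat h' z|
      ≤ (L / n) * ∑ i, ‖h (z i).1 - h' (z i).1‖ := abs_minRisk_sub_le hl hF hfhat hh hh' z
    _ ≤ (L / n) * (√n * √(∑ i, ‖h (z i).1 - h' (z i).1‖ ^ 2)) := by gcongr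
    _ = (L / √n) * √(∑ p : Fin n × Fin K, (h (z p.1).1 p.2 - h' (z p.1).1 p.2) ^ 2) := by
        rw [hsq, ← mul_assoc, div_mul_eq_mul_div, mul_div_assoc, sqrt_div_self', mul_one_div]

lemma continuous_minRisk (hl : ∀ y, LipschitzWith 1 fun u ↦ l u y)
    (hF : ∀ f ∈ F, LipschitzWith L f) (hfhat : IsEmpiricalMinimizer l H F fhat) :
    Continuous fun h : H ↦ minRisk l fhat h :=
  continuous_pi fun z ↦ continuous_of_abs_sub_le_mul_sum (v := fun (h : H) i ↦ h.1 (z i).1)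
    (continuous_pi fun i ↦ (continuous_apply (z i).1).comp continuous_subtype_val) (L / n)
    fun h h' ↦ abs_minRisk_sub_le hl hF hfhat h.2 h'.2 z

variable {D : Type*} {u : D → EuclideanSpace ℝ (Fin K) → ℝ}

/-- The Rademacher bound on the expected estimation error that a specialization of the
representation `h` incurs on a sample `z`, where `u` is a dense family of predictors. -/
def specializationError (l : ℝ → ℝ → ℝ) (u : D → EuclideanSpace ℝ (Fin K) → ℝ)
    (h : X → EuclideanSpace ℝ (Fin K)) (z : Fin n → X × ℝ) : ℝ :=
  2 / n * rademacherAverage fun k i ↦ l (u k (h (z i).1)) (z i).2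

lemma specializationError_mem_Icc [Nonempty D] (hl : ∀ u y, l u y ∈ Set.Icc (0 : ℝ) 1)
    (z : Fin n → X × ℝ) : specializationError l u h z ∈ Set.Icc (0 : ℝ) 2 := by
  have ha (k : D) (i : Fin n) : |l (u k (h (z i).1)) (z i).2| ≤ 1 :=
    abs_le_one_of_mem_Icc (hl _ _)
  refine ⟨mul_nonneg (by positivity) (rademacherAverage_nonneg ha), ?_⟩
  have hle : rademacherAverage (fun k i ↦ l (u k (h (z i).1)) (z i).2) ≤ n := by
    simpa using (le_abs_self _).trans (abs_rademacherAverage_le ha)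
  rw [specializationError, div_mul_eq_mul_div]
  exact div_le_of_le_mul₀ n.cast_nonneg zero_le_two (by gcongr)

variable [MeasurableSpace X]

lemma measurable_loss_comp (hl : Measurable fun p : ℝ × ℝ ↦ l p.1 p.2)
    {f : EuclideanSpace ℝ (Fin K) → ℝ} (hf : Measurable f) (hh : Measurable h) :
    Measurable fun p : X × ℝ ↦ l (f (h p.1)) p.2 :=
  hl.comp ((hf.comp (hh.comp measurable_fst)).prodMk measurable_snd)

lemma measurable_minRisk (hl : Measurable fun p : ℝ × ℝ ↦ l p.1 p.2) (hh : Measurable h)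
    (hcont : ∀ z, Continuous (fhat h z)) (hmeas : ∀ v, Measurable fun z ↦ fhat h z v) :
    Measurable (minRisk l fhat h) := by
  have hfhat : Measurable (uncurry fun v z ↦ fhat h z v) :=
    measurable_uncurry_of_continuous_of_measurable hcont hmeas
  refine (Finset.measurable_fun_sum _ fun i _ ↦ hl.comp (Measurable.prodMk ?_ ?_)).const_mul _
  · exact hfhat.comp ((hh.comp (by fun_prop : Measurable fun z : Fin n → X × ℝ ↦ (z i).1)).prodMk
      measurable_id)
  · fun_prop

lemma measurable_specializationError [Countable D]
    (hl : Measurable fun p : ℝ × ℝ ↦ l p.1 p.2) (hu : ∀ k, Measurable (u k)) (hh : Measurable h) :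
    Measurable (specializationError (n := n) l u h) :=
  (measurable_rademacherAverage fun k i ↦
    (measurable_loss_comp hl (hu k) hh).comp (measurable_pi_apply i)).const_mul _

variable [Countable D] [Nonempty D] {η : Measure (ProbabilityMeasure (X × ℝ))}
  [IsProbabilityMeasure η]

lemma environmentRisk_le (hn : 0 < n) (hl : IsLipschitzLoss l) (hF : ∀ f ∈ F, Continuous f)
    (hfhat : IsEmpiricalMinimizer l H F fhat)
    (hh : h ∈ H) (hhm : Measurable h) (hmeas : ∀ v, Measurable fun z ↦ fhat h z v)
    (hu : ∀ k, u k ∈ F) (hFu : F ⊆ seqClosure (Set.range u)) :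
    environmentRisk l η fhat h ≤ (∫ z, minRisk l fhat h z ∂(sampleLaw n η)) +
      ∫ z, specializationError l u h z ∂(sampleLaw n η) := by
  have hloss {f} (hf : f ∈ F) : Measurable fun p : X × ℝ ↦ l (f (h p.1)) p.2 :=
    measurable_loss_comp hl.measurable (hF f hf).measurable hhm
  have hrisk := measurable_minRisk hl.measurable hhm (fun z ↦ hF _ (hfhat h hh z).1) hmeas
  have key := integral_risk_le_of_mem_closure (n := n) (η := η) (B := 1)
    (g := fun k p ↦ l (u k (h p.1)) p.2) (ψ := fun z p ↦ l (fhat h z (h p.1)) p.2)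
    (fun k ↦ hloss (hu k)) (fun k p ↦ abs_le_one_of_mem_Icc (hl.mem_Icc _ _))
    (fun z ↦ seqClosure_subset_closure (comp_mem_seqClosure_range (hFu (hfhat h hh z).1) _
      fun p : X × ℝ ↦ (hl.lipschitz p.2).continuous))
    (fun z ↦ hloss (hfhat h hh z).1) (fun z p ↦ (hl.mem_Icc _ _).1)
    (by simpa only [minRisk, card_mul_empiricalRisk hn] using hrisk.const_mul (n : ℝ))
  simp only [← card_mul_empiricalRisk hn, integral_const_mul] at key
  have hn' : (0 : ℝ) < n := by positivity
  unfold minRisk specializationError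
  rw [integral_const_mul, ← mul_le_mul_iff_right₀ hn', mul_add, ← mul_assoc (n : ℝ) (2 / n),
    mul_div_cancel₀ _ hn'.ne']
  exact key

lemma integral_minRisk_le (hn : 0 < n) (hl : IsLipschitzLoss l) (hF : ∀ f ∈ F, Continuous f)
    (hfhat : IsEmpiricalMinimizer l H F fhat)
    (hh : h ∈ H) (hhm : Measurable h) (hmeas : ∀ v, Measurable fun z ↦ fhat h z v)
    (hu : ∀ k, u k ∈ F) (hFu : F ⊆ seqClosure (Set.range u)) :
    ∫ z, minRisk l fhat h z ∂(sampleLaw n η) ≤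
      ∫ μ, ⨅ f : F, ∫ p, l (f.1 (h p.1)) p.2 ∂(μ : Measure (X × ℝ)) ∂η := by
  have hloss {f} (hf : f ∈ F) : Measurable fun p : X × ℝ ↦ l (f (h p.1)) p.2 :=
    measurable_loss_comp hl.measurable (hF f hf).measurable hhm
  have hrisk := measurable_minRisk hl.measurable hhm (fun z ↦ hF _ (hfhat h hh z).1) hmeas
  have hbound (z : Fin n → X × ℝ) : minRisk l fhat h z ∈ Set.Icc 0 1 :=
    empiricalRisk_mem_Icc hl.mem_Icc _ _
  have hinf (μ : ProbabilityMeasure (X × ℝ)) :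
      ⨅ f : F, ∫ p, l (f.1 (h p.1)) p.2 ∂(μ : Measure (X × ℝ)) =
        ⨅ k, ∫ p, l (u k (h p.1)) p.2 ∂(μ : Measure (X × ℝ)) :=
    iInf_integral_eq_iInf_integral_comp (g := fun (f : F) (p : X × ℝ) ↦ l (f.1 (h p.1)) p.2)
      (B := 1) (fun f ↦ hloss f.2) (fun f p ↦ abs_le_one_of_mem_Icc (hl.mem_Icc _ _))
      (u := fun k ↦ ⟨u k, hu k⟩) fun f ↦ comp_mem_seqClosure_range (hFu f.2) _
        fun p : X × ℝ ↦ (hl.lipschitz p.2).continuous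
  have key := integral_sampleLaw_le_integral_iInf (n := n) (η := η) (B := 1)
    (g := fun k p ↦ l (u k (h p.1)) p.2) (φ := fun z ↦ n * minRisk l fhat h z)
    (fun k ↦ hloss (hu k)) (fun k p ↦ abs_le_one_of_mem_Icc (hl.mem_Icc _ _))
    ((integrable_of_abs_le hrisk fun z ↦ abs_le_one_of_mem_Icc (hbound z)).const_mul _)
    (fun z ↦ mul_nonneg n.cast_nonneg (hbound z).1)
    (fun z k ↦ by
      rw [← card_mul_empiricalRisk hn]
      exact mul_le_mul_of_nonneg_left ((hfhat h hh z).2 _ (hu k)) n.cast_nonneg)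
  simp only [hinf]
  rwa [integral_const_mul, mul_le_mul_iff_right₀ (by positivity)] at key

end Risks

section ExcessRisk

lemma sqrt_mul_log_div_two_div_self {m : ℝ} (hm : 0 < m) (x : ℝ) :
    √(m * x / 2) / m = √(x / m) / √2 := by
  rw [← sqrt_div' _ zero_le_two, div_eq_iff hm.ne', ← sqrt_sq hm.le, ← sqrt_mul' _ (sq_nonneg m),
    sqrt_sq hm.le]
  congr 1
  field_simp

lemma withProbAtLeast_integral_add_integral_le_of_isMin {Ω D : Type*} [MeasurableSpace Ω]
    [Countable D] [Nonempty D] {P : Measure Ω} [IsProbabilityMeasure P] {m : ℕ} (hm : 0 < m)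
    {g : D → Ω → ℝ} (hg : ∀ d, Measurable (g d)) (hg01 : ∀ d ω, g d ω ∈ Set.Icc (0 : ℝ) 1)
    {V : Ω → ℝ} {b : ℝ≥0} (hV : Measurable V) (hVb : ∀ ω, V ω ∈ Set.Icc 0 (b : ℝ)) {δ : ℝ}
    (hδ : 0 < δ) :
    WithProbAtLeast (.pi fun _ : Fin m ↦ P) δ fun Z ↦ ∀ ψ ∈ closure (Set.range g), Measurable ψ →
      (∀ d, ∑ i, ψ (Z i) ≤ ∑ i, g d (Z i)) → ∀ φ ∈ closure (Set.range g), Measurable φ →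
      (∫ ω, ψ ω ∂P) + ∫ ω, V ω ∂P ≤
        (∫ ω, φ ω ∂P) + 2 / m * rademacherAverage (fun d i ↦ g d (Z i)) +
          1 / m * ∑ i, V (Z i) + (4 + b) / √2 * √(log (1 / δ) / m) := by
  have hm' : (0 : ℝ) < m := by positivity
  have hVi : Integrable V P :=
    integrable_of_abs_le hV fun ω ↦ abs_le.2 ⟨by linarith [(hVb ω).1, b.2], (hVb ω).2⟩
  have hosc : HasBoundedDifferences (fun Z : Fin m → Ω ↦ ∑ i, V (Z i)) fun _ ↦ b :=
    hasBoundedDifferences_sum (φ := fun _ ↦ V) fun _ x y ↦ by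
      simpa [Real.dist_eq] using Real.dist_le_of_mem_Icc (hVb x) (hVb y)
  refine (withProbAtLeast_integral_le_of_isMin hm hg hg01 (by fun_prop) hosc hδ (P := P)).mono
    fun Z hZ ψ hψ hψm hmin φ hφ hφm ↦ ?_
  have h := hZ ψ hψ hψm hmin φ hφ hφm
  rw [integral_sum_eval hVi, Fintype.card_fin, ← mul_add] at h
  rw [div_mul_comm (4 + (b : ℝ)), ← sqrt_mul_log_div_two_div_self hm', ← mul_le_mul_iff_right₀ hm']
  refine h.trans_eq ?_
  field_simp

variable {X D D' : Type*} [Nonempty D] {K T n : ℕ} {l : ℝ → ℝ → ℝ}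
  {H : Set (X → EuclideanSpace ℝ (Fin K))} {F : Set (EuclideanSpace ℝ (Fin K) → ℝ)} {L : ℝ≥0}
  {d : D' → H} {u : D → EuclideanSpace ℝ (Fin K) → ℝ}

lemma specializationError_le_iSup (hl : IsLipschitzLoss l) (hF : ∀ f ∈ F, LipschitzWith L f)
    (hu : ∀ k, u k ∈ F) (hd : DenseRange d) (h : H) (z : Fin n → X × ℝ) :
    specializationError l u h z ≤ ⨆ k, specializationError l u (d k) z := by
  have hcont : Continuous fun h : H ↦ specializationError l u h z := by
    refine (continuous_of_abs_sub_le_mul_sum (v := fun (h : H) i ↦ h.1 (z i).1)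
      (continuous_pi fun i ↦ (continuous_apply (z i).1).comp continuous_subtype_val) L
      fun h h' ↦ ?_).const_mul _
    rw [Finset.mul_sum]
    exact abs_rademacherAverage_sub_le (B := 1) (fun _ _ ↦ abs_le_one_of_mem_Icc (hl.mem_Icc _ _))
      (fun _ _ ↦ abs_le_one_of_mem_Icc (hl.mem_Icc _ _))
      fun k i ↦ abs_loss_comp_sub_le hl.lipschitz (hF _ (hu k)) _ _ _
  have hbdd : BddAbove (Set.range fun k ↦ specializationError l u (d k) z) :=
    ⟨2, Set.forall_mem_range.2 fun k ↦ (specializationError_mem_Icc hl.mem_Icc z).2⟩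
  exact isClosed_property hd (isClosed_le hcont continuous_const) (le_ciSup hbdd) h

variable [MeasurableSpace X] [Countable D] [Countable D'] [Nonempty D']
  {fhat : (X → EuclideanSpace ℝ (Fin K)) → (Fin n → X × ℝ) → EuclideanSpace ℝ (Fin K) → ℝ}
  {η : Measure (ProbabilityMeasure (X × ℝ))} [IsProbabilityMeasure η]

theorem withProbAtLeast_excessRisk_add_integral_le (hT : 0 < T) (hn : 0 < n)
    (hl : IsLipschitzLoss l) (hHm : ∀ h ∈ H, Measurable h) (hd : DenseRange d)
    (hF : ∀ f ∈ F, LipschitzWith L f) (hu : ∀ k, u k ∈ F) (hFu : F ⊆ seqClosure (Set.range u))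
    (hfhat : IsEmpiricalMinimizer l H F fhat)
    (hmeas : ∀ h ∈ H, ∀ v, Measurable fun z ↦ fhat h z v)
    {V : (Fin n → X × ℝ) → ℝ} {b : ℝ≥0} (hV : Measurable V) (hVb : ∀ z, V z ∈ Set.Icc 0 (b : ℝ))
    {δ : ℝ} (hδ : 0 < δ) :
    WithProbAtLeast (.pi fun _ : Fin T ↦ sampleLaw n η) δ fun Z ↦
      ∀ h, IsMTRLSolution l H F Z h →
        environmentRisk l η fhat h - optimalRisk l η H F + ∫ z, V z ∂(sampleLaw n η) ≤
          2 / T * rademacherAverage (fun k t ↦ minRisk l fhat (d k) (Z t)) +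
            (∫ z, specializationError l u h z ∂(sampleLaw n η)) + 1 / T * ∑ t, V (Z t) +
            (4 + b) / √2 * √(log (1 / δ) / T) := by
  have hFc {f} (hf : f ∈ F) : Continuous f := (hF f hf).continuous
  have hrisk {h} (hh : h ∈ H) : Measurable (minRisk l fhat h) :=
    measurable_minRisk hl.measurable (hHm h hh) (fun z ↦ hFc (hfhat h hh z).1) (hmeas h hh)
  have hclosure {h} (hh : h ∈ H) :
      minRisk l fhat h ∈ closure (Set.range fun k ↦ minRisk l fhat (d k)) :=
    map_mem_closure (f := fun h : H ↦ minRisk l fhat h) (continuous_minRisk hl.lipschitz hF hfhat)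
      (hd ⟨h, hh⟩) (Set.mapsTo_range_iff.2 fun k ↦ ⟨k, rfl⟩)
  refine (withProbAtLeast_integral_add_integral_le_of_isMin (P := sampleLaw n η) hT
    (g := fun k ↦ minRisk l fhat (d k)) (fun k ↦ hrisk (d k).2)
    (fun k z ↦ empiricalRisk_mem_Icc hl.mem_Icc z _) hV hVb hδ).mono fun Z hZ h hsol ↦ ?_
  have hh := hsol.1
  have : Nonempty H := ⟨⟨h, hh⟩⟩
  have henv := environmentRisk_le (η := η) hn hl (fun f ↦ hFc) hfhat hh (hHm h hh) (hmeas h hh)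
    hu hFu
  rw [add_comm_sub, ← add_sub_assoc]
  refine sub_le_iff_le_add.2 (sub_le_iff_le_add'.1 (le_ciInf fun h' ↦ ?_))
  have hdev := hZ _ (hclosure hh) (hrisk hh)
    (fun k ↦ sum_minRisk_le_of_isMTRLSolution hT hfhat hsol (d k).2) _ (hclosure h'.2) (hrisk h'.2)
  have hopt := integral_minRisk_le (η := η) hn hl (fun f ↦ hFc) hfhat h'.2 (hHm h' h'.2)
    (hmeas h' h'.2) hu hFu
  linarith

theorem withProbAtLeast_excessRisk_le_integral (hT : 0 < T) (hn : 0 < n)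
    (hl : IsLipschitzLoss l) (hHm : ∀ h ∈ H, Measurable h) (hd : DenseRange d)
    (hF : ∀ f ∈ F, LipschitzWith L f) (hu : ∀ k, u k ∈ F) (hFu : F ⊆ seqClosure (Set.range u))
    (hfhat : IsEmpiricalMinimizer l H F fhat)
    (hmeas : ∀ h ∈ H, ∀ v, Measurable fun z ↦ fhat h z v) {δ : ℝ} (hδ : 0 < δ) :
    WithProbAtLeast (.pi fun _ : Fin T ↦ sampleLaw n η) δ fun Z ↦
      ∀ h, IsMTRLSolution l H F Z h →
        environmentRisk l η fhat h - optimalRisk l η H F ≤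
          2 / T * rademacherAverage (fun k t ↦ minRisk l fhat (d k) (Z t)) +
            (∫ z, specializationError l u h z ∂(sampleLaw n η)) + √(8 * log (1 / δ) / T) := by
  refine (withProbAtLeast_excessRisk_add_integral_le (V := fun _ ↦ 0) (b := 0) (η := η) hT hn hl
    hHm hd hF hu hFu hfhat hmeas measurable_const (fun _ ↦ by simp) hδ).mono fun Z hZ h hsol ↦ ?_
  have hconst : 4 / √2 = √8 := by
    rw [div_eq_iff (by positivity), ← sqrt_mul (by norm_num)]
    exact (sqrt_eq_iff_mul_self_eq_of_pos (by norm_num)).2 (by norm_num) |>.symm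
  rw [mul_div_assoc, sqrt_mul (by norm_num), ← hconst]
  simpa using hZ h hsol

theorem withProbAtLeast_excessRisk_le_average (hT : 0 < T) (hn : 0 < n)
    (hl : IsLipschitzLoss l) (hHm : ∀ h ∈ H, Measurable h) (hd : DenseRange d)
    (hF : ∀ f ∈ F, LipschitzWith L f) (hu : ∀ k, u k ∈ F) (hFu : F ⊆ seqClosure (Set.range u))
    (hfhat : IsEmpiricalMinimizer l H F fhat)
    (hmeas : ∀ h ∈ H, ∀ v, Measurable fun z ↦ fhat h z v) {δ : ℝ} (hδ : 0 < δ) :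
    WithProbAtLeast (.pi fun _ : Fin T ↦ sampleLaw n η) δ fun Z ↦
      ∀ h, IsMTRLSolution l H F Z h →
        environmentRisk l η fhat h - optimalRisk l η H F ≤
          2 / T * rademacherAverage (fun k t ↦ minRisk l fhat (d k) (Z t)) +
            1 / T * ∑ t, (⨆ k, specializationError l u (d k) (Z t)) +
            5 * √(log (1 / δ) / T) := by
  have hum (k : D) : Measurable (u k) := (hF _ (hu k)).continuous.measurable
  have hmem (h : X → EuclideanSpace ℝ (Fin K)) (z : Fin n → X × ℝ) :
      specializationError l u h z ∈ Set.Icc (0 : ℝ) 2 := specializationError_mem_Icc hl.mem_Icc z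
  have hVm : Measurable fun z : Fin n → X × ℝ ↦ ⨆ k, specializationError l u (d k) z :=
    .iSup fun k ↦ measurable_specializationError hl.measurable hum (hHm _ (d k).2)
  have hV (z : Fin n → X × ℝ) : ⨆ k, specializationError l u (d k) z ∈ Set.Icc (0 : ℝ) 2 :=
    ⟨Real.iSup_nonneg fun k ↦ (hmem _ z).1, ciSup_le fun k ↦ (hmem _ z).2⟩
  have habs {x : ℝ} (hx : x ∈ Set.Icc (0 : ℝ) 2) : |x| ≤ 2 := by rw [abs_of_nonneg hx.1]; exact hx.2
  refine (withProbAtLeast_excessRisk_add_integral_le (b := 2) (η := η) hT hn hl hHm hd hF hu hFu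
    hfhat hmeas hVm hV hδ).mono fun Z hZ h hsol ↦ ?_
  have hle : ∫ z, specializationError l u h z ∂(sampleLaw n η) ≤
      ∫ z, ⨆ k, specializationError l u (d k) z ∂(sampleLaw n η) :=
    integral_mono
      (integrable_of_abs_le (measurable_specializationError hl.measurable hum (hHm h hsol.1))
        fun z ↦ habs (hmem h z))
      (integrable_of_abs_le hVm fun z ↦ habs (hV z))
      fun z ↦ specializationError_le_iSup hl hF hu hd ⟨h, hsol.1⟩ z
  have hconst : (4 + 2) / √2 ≤ 5 := by
    rw [div_le_iff₀ (by positivity), ← div_le_iff₀' (by norm_num)]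
    exact le_sqrt_of_sq_le (by norm_num)
  have hexcess := hZ h hsol
  have hdev := mul_le_mul_of_nonneg_right hconst (sqrt_nonneg (log (1 / δ) / T))
  rw [NNReal.coe_ofNat] at hexcess
  linarith

end ExcessRisk

section GaussianBounds

lemma gaussianAverage_mono {ι : Type*} [Fintype ι] {S S' : Set (ι → ℝ)} (h : S ⊆ S') :
    gaussianAverage S ≤ gaussianAverage S' :=
  extExpectation_mono fun _ ↦ biSup_mono h

lemma two_mul_sqrt_pi_div_two : 2 * √(π / 2) = √(2 * π) := by
  rw [show 2 * π = 2 ^ 2 * (π / 2) by ring, sqrt_mul (by positivity), sqrt_sq zero_le_two]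

variable {X : Type*} {K T n : ℕ} {l : ℝ → ℝ → ℝ} {H : Set (X → EuclideanSpace ℝ (Fin K))}
  {F : Set (EuclideanSpace ℝ (Fin K) → ℝ)} {L q : ℝ≥0}

lemma rademacherAverage_minRisk_le {D : Type*} [Nonempty D]
    {fhat : (X → EuclideanSpace ℝ (Fin K)) → (Fin n → X × ℝ) → EuclideanSpace ℝ (Fin K) → ℝ}
    (hl : ∀ y, LipschitzWith 1 fun u ↦ l u y) (hF : ∀ f ∈ F, LipschitzWith L f)
    (hfhat : IsEmpiricalMinimizer l H F fhat) (d : D → H) (Z : Fin T → Fin n → X × ℝ) :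
    ((2 / T * rademacherAverage (fun k t ↦ minRisk l fhat (d k) (Z t)) : ℝ) : EReal) ≤
      ((√(2 * π) * L / (T * √n) : ℝ) : EReal) * gaussianAverage (representationSet H Z) := by
  let v (k : D) (p : Fin T × Fin n × Fin K) : ℝ := (d k).1 (Z p.1 p.2.1).1 p.2.2
  have hsub : Set.range v ⊆ representationSet H Z :=
    Set.range_subset_iff.2 fun k ↦ ⟨d k, (d k).2, rfl⟩
  have hcoef : 2 / T * (L / √n * √(π / 2)) = √(2 * π) * L / (T * √n) := by
    rw [← two_mul_sqrt_pi_div_two]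
    ring
  rw [← hcoef, EReal.coe_mul, EReal.coe_mul (2 / T), mul_assoc]
  refine mul_le_mul_of_nonneg_left ?_ (EReal.coe_nonneg.2 (by positivity))
  calc ((rademacherAverage fun k t ↦ minRisk l fhat (d k) (Z t) : ℝ) : EReal)
      ≤ ((L / √n * √(π / 2) : ℝ) : EReal) * gaussianAverage (Set.range v) :=
        rademacherAverage_le_gaussianAverage (by positivity) fun k k' t ↦
          abs_minRisk_sub_le_sqrt hl hF hfhat (d k).2 (d k').2 (Z t)
    _ ≤ ((L / √n * √(π / 2) : ℝ) : EReal) * gaussianAverage (representationSet H Z) :=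
        mul_le_mul_of_nonneg_left (gaussianAverage_mono hsub) (EReal.coe_nonneg.2 (by positivity))

lemma nontrivial_piLp_euclideanSpace (hK : 0 < K) (hn : 0 < n) :
    Nontrivial (PiLp 2 fun _ : Fin n ↦ EuclideanSpace ℝ (Fin K)) := by
  have : NeZero K := ⟨hK.ne'⟩
  have : NeZero n := ⟨hn.ne'⟩
  infer_instance

lemma exists_qPrime_eq_coe (hK : 0 < K) (hn : 0 < n) (hF : F.Nonempty) (hF_q : qPrime n F ≠ ⊤) :
    ∃ q : ℝ≥0, qPrime n F = ((q : ℝ) : EReal) := by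
  have := nontrivial_piLp_euclideanSpace hK hn
  obtain ⟨y, hy⟩ := exists_ne (0 : PiLp 2 fun _ : Fin n ↦ EuclideanSpace ℝ (Fin K))
  have hnonneg : 0 ≤ qPrime n F := le_iSup₂_of_le y hy
    (mul_nonneg (EReal.coe_nonneg.2 (by positivity)) (gaussianAverage_nonneg (hF.image _)))
  refine ⟨⟨_, EReal.toReal_nonneg hnonneg⟩, (EReal.coe_toReal hF_q fun h ↦ ?_).symm⟩
  simp [h] at hnonneg

lemma gaussianAverage_le_of_qPrime_eq (hq : qPrime n F = ((q : ℝ) : EReal))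
    {y : PiLp 2 fun _ : Fin n ↦ EuclideanSpace ℝ (Fin K)} (hy : y ≠ 0) :
    gaussianAverage ((fun f (i : Fin n) ↦ f (y i)) '' F) ≤ ((q * ‖y‖ : ℝ) : EReal) := by
  have hnorm : 0 < ‖y‖ := norm_pos_iff.2 hy
  have hle : ((1 / ‖y‖ : ℝ) : EReal) * gaussianAverage ((fun f (i : Fin n) ↦ f (y i)) '' F) ≤
      ((q : ℝ) : EReal) := hq ▸ le_iSup₂_of_le y hy le_rfl
  calc gaussianAverage ((fun f (i : Fin n) ↦ f (y i)) '' F)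
      = ((1 / ‖y‖ : ℝ) : EReal) * gaussianAverage ((fun f (i : Fin n) ↦ f (y i)) '' F) *
          (‖y‖ : ℝ) := by
        rw [mul_right_comm, ← EReal.coe_mul, one_div_mul_cancel hnorm.ne', EReal.coe_one, one_mul]
    _ ≤ ((q : ℝ) : EReal) * (‖y‖ : ℝ) :=
        mul_le_mul_of_nonneg_right hle (EReal.coe_nonneg.2 hnorm.le)
    _ = ((q * ‖y‖ : ℝ) : EReal) := (EReal.coe_mul _ _).symm

lemma le_of_forall_ne_zero_le {V : Type*} [NormedAddCommGroup V] [NormedSpace ℝ V] [Nontrivial V]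
    {f g : V → ℝ} (hf : Continuous f) (hg : Continuous g) (h : ∀ x ≠ 0, f x ≤ g x) (x : V) :
    f x ≤ g x := by
  have : (𝓝[≠] (0 : V)).NeBot := Module.punctured_nhds_neBot ℝ V 0
  exact isClosed_property (dense_compl_singleton (0 : V)).denseRange_val (isClosed_le hf hg)
    (fun x ↦ h x.1 x.2) x

variable {D : Type*} [Nonempty D] {u : D → EuclideanSpace ℝ (Fin K) → ℝ}

lemma rademacherAverage_loss_comp_le (hK : 0 < K) (hn : 0 < n) (hl : IsLipschitzLoss l)
    (hF : ∀ f ∈ F, LipschitzWith L f) (hq : qPrime n F = ((q : ℝ) : EReal)) (hu : ∀ k, u k ∈ F)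
    (w : Fin n → ℝ) (y : PiLp 2 fun _ : Fin n ↦ EuclideanSpace ℝ (Fin K)) :
    rademacherAverage (fun k i ↦ l (u k (y i)) (w i)) ≤ √(π / 2) * (q * ‖y‖) := by
  have := nontrivial_piLp_euclideanSpace hK hn
  refine le_of_forall_ne_zero_le
    (f := fun y : PiLp 2 fun _ : Fin n ↦ EuclideanSpace ℝ (Fin K) ↦
      rademacherAverage fun k i ↦ l (u k (y i)) (w i)) (g := fun y ↦ √(π / 2) * (q * ‖y‖)) ?_
    (by fun_prop) (fun y hy ↦ ?_) y
  · refine continuous_of_abs_sub_le_mul_sum (PiLp.continuous_ofLp _ _) L fun y y' ↦ ?_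
    rw [Finset.mul_sum]
    exact abs_rademacherAverage_sub_le (B := 1) (fun _ _ ↦ abs_le_one_of_mem_Icc (hl.mem_Icc _ _))
      (fun _ _ ↦ abs_le_one_of_mem_Icc (hl.mem_Icc _ _))
      fun k i ↦ abs_loss_comp_sub_le hl.lipschitz (hF _ (hu k)) _ _ _
  · have hsub : Set.range (fun k i ↦ u k (y i)) ⊆ (fun f (i : Fin n) ↦ f (y i)) '' F :=
      Set.range_subset_iff.2 fun k ↦ ⟨u k, hu k, rfl⟩
    have hcomp := rademacherAverage_le_gaussianAverage_of_abs_sub_le zero_le_one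
      (a := fun k i ↦ l (u k (y i)) (w i)) (v := fun k i ↦ u k (y i)) fun k k' i ↦ by
        simpa [Real.dist_eq] using (hl.lipschitz (w i)).dist_le_mul (u k (y i)) (u k' (y i))
    rw [← EReal.coe_le_coe_iff, EReal.coe_mul]
    rw [one_mul] at hcomp
    exact hcomp.trans (mul_le_mul_of_nonneg_left
      ((gaussianAverage_mono hsub).trans (gaussianAverage_le_of_qPrime_eq hq hy))
      (EReal.coe_nonneg.2 (sqrt_nonneg _)))

lemma ofReal_specializationError_le (hK : 0 < K) (hn : 0 < n) (hl : IsLipschitzLoss l)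
    (hF : ∀ f ∈ F, LipschitzWith L f) (hq : qPrime n F = ((q : ℝ) : EReal)) (hu : ∀ k, u k ∈ F)
    (h : X → EuclideanSpace ℝ (Fin K)) (z : Fin n → X × ℝ) :
    ENNReal.ofReal (specializationError l u h z) ≤
      ENNReal.ofReal (√(2 * π) / n * q) * ‖representedSample h z‖ₑ := by
  have hle := rademacherAverage_loss_comp_le hK hn hl hF hq hu (fun i ↦ (z i).2)
    (representedSample h z)
  rw [← ofReal_norm, ← ENNReal.ofReal_mul (by positivity), ← two_mul_sqrt_pi_div_two]
  refine ENNReal.ofReal_le_ofReal ((mul_le_mul_of_nonneg_left hle (by positivity)).trans_eq ?_)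
  ring

lemma ofReal_iSup_le {ι : Type*} [Nonempty ι] {a : ι → ℝ} {M : ℝ≥0∞}
    (h : ∀ i, ENNReal.ofReal (a i) ≤ M) : ENNReal.ofReal (⨆ i, a i) ≤ M := by
  rcases eq_or_ne M ⊤ with rfl | hM
  · exact le_top
  · exact ENNReal.ofReal_le_of_le_toReal
      (ciSup_le fun i ↦ (ENNReal.ofReal_le_iff_le_toReal hM).1 (h i))

lemma coe_le_coe_mul_coe_of_ofReal_le {x c : ℝ} {S : ℝ≥0∞} (hc : 0 ≤ c)
    (h : ENNReal.ofReal x ≤ ENNReal.ofReal c * S) : (x : EReal) ≤ (c : EReal) * (S : EReal) := by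
  rw [← EReal.coe_ennreal_le_coe_ennreal_iff, EReal.coe_ennreal_mul, EReal.coe_ennreal_ofReal,
    EReal.coe_ennreal_ofReal, max_eq_left hc] at h
  exact (EReal.coe_le_coe_iff.2 (le_max_left _ _)).trans h

lemma average_iSup_specializationError_le {D' : Type*} [Nonempty D'] {d : D' → H} (hK : 0 < K)
    (hT : 0 < T) (hn : 0 < n) (hl : IsLipschitzLoss l) (hF : ∀ f ∈ F, LipschitzWith L f)
    (hq : qPrime n F = ((q : ℝ) : EReal)) (hu : ∀ k, u k ∈ F) (Z : Fin T → Fin n → X × ℝ) :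
    ((1 / T * ∑ t, (⨆ k, specializationError l u (d k) (Z t)) : ℝ) : EReal) ≤
      ((√(2 * π) / n : ℝ) : EReal) * qPrime n F *
        (((1 / T) * ∑ t, ⨆ h ∈ H, ‖representedSample h (Z t)‖ₑ : ℝ≥0∞) : EReal) := by
  rw [hq, ← EReal.coe_mul]
  refine coe_le_coe_mul_coe_of_ofReal_le (by positivity) ?_
  have hnonneg (t : Fin T) : 0 ≤ ⨆ k, specializationError l u (d k) (Z t) :=
    Real.iSup_nonneg fun k ↦ (specializationError_mem_Icc hl.mem_Icc _).1
  rw [ENNReal.ofReal_mul (by positivity), ENNReal.ofReal_sum_of_nonneg fun t _ ↦ hnonneg t,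
    ENNReal.ofReal_div_of_pos (by positivity), ENNReal.ofReal_one, ENNReal.ofReal_natCast,
    mul_left_comm]
  gcongr
  rw [Finset.mul_sum]
  refine Finset.sum_le_sum fun t _ ↦ ofReal_iSup_le fun k ↦ ?_
  exact (ofReal_specializationError_le hK hn hl hF hq hu _ _).trans
    (by gcongr; exact le_iSup₂_of_le (d k).1 (d k).2 le_rfl)

lemma enorm_representedSample_sq (h : X → EuclideanSpace ℝ (Fin K)) (z : Fin n → X × ℝ) :
    ‖representedSample h z‖ₑ ^ 2 = ∑ i, ‖h (z i).1‖ₑ ^ 2 := by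
  simp only [← ofReal_norm, ← ENNReal.ofReal_pow (norm_nonneg _)]
  rw [PiLp.norm_sq_eq_of_L2, ENNReal.ofReal_sum_of_nonneg fun _ _ ↦ sq_nonneg _]
  rfl

variable [MeasurableSpace X] {η : Measure (ProbabilityMeasure (X × ℝ))} [IsProbabilityMeasure η]
  {h : X → EuclideanSpace ℝ (Fin K)}

lemma lintegral_enorm_representedSample_le (hn : 0 < n) (hh : Measurable h) :
    ∫⁻ z, ‖representedSample h z‖ₑ ∂(sampleLaw n η) ≤
      n * ((∫⁻ p, ‖h p.1‖ₑ ^ 2 ∂(mixture η)) / n) ^ (1 / 2 : ℝ) := by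
  have hmeas : Measurable fun z : Fin n → X × ℝ ↦ representedSample h z :=
    (WithLp.measurable_toLp 2 _).comp (by fun_prop)
  have hn0 : (n : ℝ≥0∞) ≠ 0 := by exact_mod_cast hn.ne'
  have hsecond : ∫⁻ z, ‖representedSample h z‖ₑ ^ 2 ∂(sampleLaw n η) =
      (n : ℝ≥0∞) ^ (2 : ℝ) * ((∫⁻ p, ‖h p.1‖ₑ ^ 2 ∂(mixture η)) / n) := by
    simp only [enorm_representedSample_sq]
    rw [lintegral_sum_sampleLaw (φ := fun p ↦ ‖h p.1‖ₑ ^ 2) (by fun_prop), ENNReal.rpow_two, sq,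
      mul_assoc, ENNReal.mul_div_cancel hn0 (ENNReal.natCast_ne_top n)]
  have hcauchy := ENNReal.lintegral_mul_le_Lp_mul_Lq (sampleLaw n η) Real.HolderConjugate.two_two
    hmeas.enorm.aemeasurable (g := fun _ ↦ 1) aemeasurable_const
  simp only [Pi.mul_apply, mul_one, lintegral_const, measure_univ, ENNReal.rpow_two, one_pow,
    ENNReal.one_rpow] at hcauchy
  refine hcauchy.trans_eq ?_
  rw [hsecond, ENNReal.mul_rpow_of_nonneg _ _ (by norm_num), ← ENNReal.rpow_mul]
  norm_num

lemma integral_specializationError_le [Countable D] (hK : 0 < K) (hn : 0 < n)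
    (hl : IsLipschitzLoss l) (hF : ∀ f ∈ F, LipschitzWith L f)
    (hq : qPrime n F = ((q : ℝ) : EReal)) (hu : ∀ k, u k ∈ F) (hh : Measurable h) :
    ((∫ z, specializationError l u h z ∂(sampleLaw n η) : ℝ) : EReal) ≤
      ((√(2 * π) : ℝ) : EReal) * qPrime n F *
        ((((∫⁻ p, ‖h p.1‖ₑ ^ 2 ∂(mixture η)) / n) ^ (1 / 2 : ℝ) : ℝ≥0∞) : EReal) := by
  have hmem (z : Fin n → X × ℝ) : specializationError l u h z ∈ Set.Icc (0 : ℝ) 2 :=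
    specializationError_mem_Icc hl.mem_Icc z
  have hint : Integrable (specializationError l u h) (sampleLaw n η) :=
    integrable_of_abs_le (B := 2) (measurable_specializationError hl.measurable
      (fun k ↦ (hF _ (hu k)).continuous.measurable) hh) fun z ↦ by
        rw [abs_of_nonneg (hmem z).1]
        exact (hmem z).2
  have hcoef : ENNReal.ofReal (√(2 * π) / n * q) * n = ENNReal.ofReal (√(2 * π) * q) := by
    rw [← ENNReal.ofReal_natCast, ← ENNReal.ofReal_mul (by positivity)]
    congr 1
    field_simp
  rw [hq, ← EReal.coe_mul]
  refine coe_le_coe_mul_coe_of_ofReal_le (by positivity) ?_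
  rw [ofReal_integral_eq_lintegral_ofReal hint (.of_forall fun z ↦ (hmem z).1), ← hcoef, mul_assoc]
  calc ∫⁻ z, ENNReal.ofReal (specializationError l u h z) ∂(sampleLaw n η)
      ≤ ∫⁻ z, ENNReal.ofReal (√(2 * π) / n * q) * ‖representedSample h z‖ₑ ∂(sampleLaw n η) :=
        lintegral_mono (ofReal_specializationError_le hK hn hl hF hq hu h)
    _ = ENNReal.ofReal (√(2 * π) / n * q) * ∫⁻ z, ‖representedSample h z‖ₑ ∂(sampleLaw n η) :=
        lintegral_const_mul' _ _ ENNReal.ofReal_ne_top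
    _ ≤ _ := by
        gcongr
        exact lintegral_enorm_representedSample_le hn hh

end GaussianBounds

section ExcessRiskBounds

variable {X D D' : Type*} [MeasurableSpace X] [Countable D] [Nonempty D] [Countable D']
  [Nonempty D'] {K T n : ℕ} {l : ℝ → ℝ → ℝ} {H : Set (X → EuclideanSpace ℝ (Fin K))}
  {F : Set (EuclideanSpace ℝ (Fin K) → ℝ)} {L q : ℝ≥0} {d : D' → H}
  {u : D → EuclideanSpace ℝ (Fin K) → ℝ}
  {fhat : (X → EuclideanSpace ℝ (Fin K)) → (Fin n → X × ℝ) → EuclideanSpace ℝ (Fin K) → ℝ}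
  {η : Measure (ProbabilityMeasure (X × ℝ))} [IsProbabilityMeasure η]

theorem withProbAtLeast_excessRisk_le_of_secondMoment (hK : 0 < K) (hT : 0 < T) (hn : 0 < n)
    (hl : IsLipschitzLoss l) (hHm : ∀ h ∈ H, Measurable h) (hd : DenseRange d)
    (hF : ∀ f ∈ F, LipschitzWith L f) (hq : qPrime n F = ((q : ℝ) : EReal)) (hu : ∀ k, u k ∈ F)
    (hFu : F ⊆ seqClosure (Set.range u)) (hfhat : IsEmpiricalMinimizer l H F fhat)
    (hmeas : ∀ h ∈ H, ∀ v, Measurable fun z ↦ fhat h z v) {δ : ℝ} (hδ : 0 < δ) :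
    WithProbAtLeast (.pi fun _ : Fin T ↦ sampleLaw n η) δ fun Z ↦
      ∀ h, IsMTRLSolution l H F Z h →
        ((environmentRisk l η fhat h - optimalRisk l η H F : ℝ) : EReal) ≤
          ((√(2 * π) * L / (T * √n) : ℝ) : EReal) * gaussianAverage (representationSet H Z) +
            ((√(2 * π) : ℝ) : EReal) * qPrime n F *
              ((⨆ h ∈ H, ((∫⁻ p, ‖h p.1‖ₑ ^ 2 ∂(mixture η)) / n) ^ (1 / 2 : ℝ) : ℝ≥0∞) : EReal) +
            ((√(8 * log (1 / δ) / T) : ℝ) : EReal) := by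
  refine (withProbAtLeast_excessRisk_le_integral hT hn hl hHm hd hF hu hFu hfhat hmeas hδ).mono
    fun Z hZ h hsol ↦ (EReal.coe_le_coe_iff.2 (hZ h hsol)).trans ?_
  have hq0 : 0 ≤ qPrime n F := hq ▸ EReal.coe_nonneg.2 q.2
  have hspec := integral_specializationError_le (η := η) hK hn hl hF hq hu (hHm h hsol.1)
  refine add_le_add (add_le_add (rademacherAverage_minRisk_le hl.lipschitz hF hfhat d Z)
    (hspec.trans ?_)) (EReal.coe_le_coe_iff.2 le_rfl)
  exact mul_le_mul_of_nonneg_left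
    (EReal.coe_ennreal_le_coe_ennreal_iff.2 (le_iSup₂_of_le h hsol.1 le_rfl))
    (mul_nonneg (EReal.coe_nonneg.2 (sqrt_nonneg _)) hq0)

theorem withProbAtLeast_excessRisk_le_of_sampleNorms (hK : 0 < K) (hT : 0 < T) (hn : 0 < n)
    (hl : IsLipschitzLoss l) (hHm : ∀ h ∈ H, Measurable h) (hd : DenseRange d)
    (hF : ∀ f ∈ F, LipschitzWith L f) (hq : qPrime n F = ((q : ℝ) : EReal)) (hu : ∀ k, u k ∈ F)
    (hFu : F ⊆ seqClosure (Set.range u)) (hfhat : IsEmpiricalMinimizer l H F fhat)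
    (hmeas : ∀ h ∈ H, ∀ v, Measurable fun z ↦ fhat h z v) {δ : ℝ} (hδ : 0 < δ) :
    WithProbAtLeast (.pi fun _ : Fin T ↦ sampleLaw n η) δ fun Z ↦
      ∀ h, IsMTRLSolution l H F Z h →
        ((environmentRisk l η fhat h - optimalRisk l η H F : ℝ) : EReal) ≤
          ((√(2 * π) * L / (T * √n) : ℝ) : EReal) * gaussianAverage (representationSet H Z) +
            ((√(2 * π) / n : ℝ) : EReal) * qPrime n F *
              (((1 / T) * ∑ t, ⨆ h ∈ H, ‖representedSample h (Z t)‖ₑ : ℝ≥0∞) : EReal) +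
            ((5 * √(log (1 / δ) / T) : ℝ) : EReal) :=
  (withProbAtLeast_excessRisk_le_average hT hn hl hHm hd hF hu hFu hfhat hmeas hδ).mono
    fun Z hZ h hsol ↦ (EReal.coe_le_coe_iff.2 (hZ h hsol)).trans
      (add_le_add (add_le_add (rademacherAverage_minRisk_le hl.lipschitz hF hfhat d Z)
        (average_iSup_specializationError_le hK hT hn hl hF hq hu Z))
        (EReal.coe_le_coe_iff.2 le_rfl))

end ExcessRiskBounds

end

theorem theorem2 {X : Type*} [MeasurableSpace X] {K T n : ℕ}
    (hK : 0 < K) (hT : 0 < T) (hn : 0 < n)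
    -- the loss function
    (l : ℝ → ℝ → ℝ) (hl_meas : Measurable fun p : ℝ × ℝ => l p.1 p.2)
    (hl_range : ∀ u y, l u y ∈ Set.Icc (0 : ℝ) 1)
    (hl_lip : ∀ y, LipschitzWith 1 fun u => l u y)
    -- the class of representations, separable for pointwise convergence
    (H : Set (X → EuclideanSpace ℝ (Fin K))) (hH_meas : ∀ h ∈ H, Measurable h)
    (hH_sep : TopologicalSpace.SeparableSpace H)
    -- the class of specialized predictors
    (F : Set (EuclideanSpace ℝ (Fin K) → ℝ)) (L : NNReal) (hL : 0 < L)
    (hF_lip : ∀ f ∈ F, LipschitzWith L f) (hF_q : qPrime n F ≠ ⊤)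
    -- the environment
    (η : Measure (ProbabilityMeasure (X × ℝ))) [IsProbabilityMeasure η]
    -- the empirical risk minimizers that specialize a representation to a new task
    (fhat : (X → EuclideanSpace ℝ (Fin K)) → (Fin n → X × ℝ) → EuclideanSpace ℝ (Fin K) → ℝ)
    (hfhat : IsEmpiricalMinimizer l H F fhat)
    (hfhat_meas : ∀ h ∈ H, ∀ v, Measurable fun z => fhat h z v)
    (δ : ℝ) (hδ : 0 < δ) :
    WithProbAtLeast (Measure.pi fun _ : Fin T => sampleLaw n η) δ (fun Z =>
      ∀ hhat, IsMTRLSolution l H F Z hhat →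
        ((environmentRisk l η fhat hhat - optimalRisk l η H F : ℝ) : EReal) ≤
          ((√(2 * Real.pi) * L / (T * √n) : ℝ) : EReal) * gaussianAverage (representationSet H Z)
          + ((√(2 * Real.pi) : ℝ) : EReal) * qPrime n F *
            ((⨆ h ∈ H, ((∫⁻ p, ‖h p.1‖ₑ ^ 2 ∂(mixture η)) / n) ^ (1 / 2 : ℝ) : ENNReal) : EReal)
          + ((√(8 * Real.log (4 / δ) / T) : ℝ) : EReal)) ∧
    WithProbAtLeast (Measure.pi fun _ : Fin T => sampleLaw n η) δ (fun Z =>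
      ∀ hhat, IsMTRLSolution l H F Z hhat →
        ((environmentRisk l η fhat hhat - optimalRisk l η H F : ℝ) : EReal) ≤
          ((√(2 * Real.pi) * L / (T * √n) : ℝ) : EReal) * gaussianAverage (representationSet H Z)
          + ((√(2 * Real.pi) / n : ℝ) : EReal) * qPrime n F *
            (((1 / T) * ∑ t, ⨆ h ∈ H, ‖representedSample h (Z t)‖ₑ : ENNReal) : EReal)
          + ((5 * √(Real.log (8 / δ) / T) : ℝ) : EReal)) := by
  have hl : IsLipschitzLoss l := ⟨hl_meas, hl_range, hl_lip⟩
  rcases H.eq_empty_or_nonempty with hH | ⟨h₀, hh₀⟩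
  · have hnot (h) : h ∉ H := hH ▸ Set.notMem_empty h
    exact ⟨withProbAtLeast_of_forall hδ.le fun Z h hsol ↦ absurd hsol.1 (hnot h),
      withProbAtLeast_of_forall hδ.le fun Z h hsol ↦ absurd hsol.1 (hnot h)⟩
  have : Nonempty H := ⟨⟨h₀, hh₀⟩⟩
  have hd := TopologicalSpace.denseRange_denseSeq H
  obtain ⟨μ⟩ := nonempty_of_isProbabilityMeasure η
  obtain ⟨p⟩ := nonempty_of_isProbabilityMeasure (μ : Measure (X × ℝ))
  have hF : F.Nonempty := ⟨_, (hfhat h₀ hh₀ fun _ ↦ p).1⟩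
  obtain ⟨u, hu, hFu⟩ := exists_seq_subset_seqClosure_range (fun f hf ↦ (hF_lip f hf).continuous) hF
  obtain ⟨q, hq⟩ := exists_qPrime_eq_coe hK hn hF hF_q
  exact ⟨(withProbAtLeast_excessRisk_le_of_secondMoment hK hT hn hl hH_meas hd hF_lip hq hu hFu
      hfhat hfhat_meas hδ).mono fun Z hZ h hsol ↦ (hZ h hsol).trans
        (add_le_add le_rfl (EReal.coe_le_coe_iff.2 (by gcongr; norm_num))),
    (withProbAtLeast_excessRisk_le_of_sampleNorms hK hT hn hl hH_meas hd hF_lip hq hu hFu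
      hfhat hfhat_meas hδ).mono fun Z hZ h hsol ↦ (hZ h hsol).trans
        (add_le_add le_rfl (EReal.coe_le_coe_iff.2 (by gcongr; norm_num)))⟩
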